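/- **Theorem.** Let $\{w_i\}_{i=1}^n$ be a basis of $\mathbb{R}^n$ and let $S\subseteq[n]$ have cardinality $d$. Let $(S_1,\dots,S_m)$ be a uniform cover of $S$ with weights $(p_1,\dots,p_m)$, that is, $S_j\subseteq S$ and $p_j>0$ for all $j$, and $\sum_{j:\,i\in S_j}p_j=1$ for every $i\in S$. Put $p=\sum_{j=1}^m p_j$, $H=\mathrm{span}\{w_k:k\in S\}$, $H_j=\mathrm{span}\{w_k:k\in S_j\}$, $\widetilde H_j=\mathrm{span}\{w_k:k\in S\setminus S_j\}$, $d_j=\dim H_j=|S_j|$ and $\widetilde d_j=\dim\widetilde H_j=d-d_j$. For $A\subseteq[n]$ let $|\wedge_{k\in A}w_k|$ be the $|A|$-dimensional volume of the parallelepiped spanned by the vectors $w_k$, $k\in A$ (equal to $1$ if $A=\emptyset$). For a linear subspace $F\subseteq\mathbb{R}^n$ and $f:\mathbb{R}^n\to[0,\infty)$ let $P_Ff(x)=\sup_{y\in F^\perp}f(x+y)$ for $x\in F$, and let $\|P_Ff\|_1$ be the integral of $P_Ff$ over $F$ with respect to the Lebesgue measure of $F$; likewise $\|f\|_1=\int_{\mathbb{R}^n}f$.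 (These quantities are read in $[0,\infty]$, with $0\cdot\infty=0$, $0^0=\infty^0=1$, and $0^{s}=\infty$, $\infty^{s}=0$ for $s<0$.) Then for every integrable log-concave $f:\mathbb{R}^n\to[0,\infty)$ the following four inequalities hold: $$\|P_{H^\perp}f\|_1^{p-1}\|f\|_1\le\frac{d!\,\prod_{j=1}^m|\wedge_{k\in S\setminus S_j}w_k|^{p_j}}{|\wedge_{i\in S}w_i|^{p-1}\prod_{j=1}^m(d_j!)^{p_j}}\prod_{j=1}^m\|P_{\widetilde H_j^\perp}f\|_1^{p_j},$$ $$\|P_{H^\perp}f\|_1\|f\|_1^{p-1}\le\frac{(d!)^{p-1}\prod_{j=1}^m|\wedge_{k\in S_j}w_k|^{p_j}}{|\wedge_{i\in S}w_i|\prod_{j=1}^m(\widetilde d_j!)^{p_j}}\prod_{j=1}^m\|P_{H_j^\perp}f\|_1^{p_j},$$ $$\|P_{H^\perp}f\|_1^{p-1}\|f\|_1\le\frac{d!\,\prod_{j=1}^m|\wedge_{k\in S_j}w_k|^{p_j}}{|\wedge_{i\in S}w_i|\prod_{j=1}^m(d_j!)^{p_j}}\prod_{j=1}^m\|P_{H_j\oplus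 H^\perp}f\|_1^{p_j},$$ $$\|P_{H^\perp}f\|_1\|f\|_1^{p-1}\le\frac{(d!)^{p-1}\prod_{j=1}^m|\wedge_{k\in S\setminus S_j}w_k|^{p_j}}{|\wedge_{i\in S}w_i|^{p-1}\prod_{j=1}^m(\widetilde d_j!)^{p_j}}\prod_{j=1}^m\|P_{\widetilde H_j\oplus H^\perp}f\|_1^{p_j}.$$ -/

import Mathlib

open MeasureTheory
open scoped ENNReal Nat

/-- `(T j)_j` is a uniform cover of `S` with (positive) weights `(q j)_j`: the `T j` are subsets
of `S`, not necessarily distinct, and every `i ∈ S` is covered with total weight `1`. -/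
structure IsUniformCover {n m : ℕ} (S : Finset (Fin n)) (T : Fin m → Finset (Fin n))
    (q : Fin m → ℝ) : Prop where
  weight_pos : ∀ j, 0 < q j
  subset : ∀ j, T j ⊆ S
  cover : ∀ i ∈ S, ∑ j, q j * (if i ∈ T j then 1 else 0) = 1

/-- A function `f : ℝⁿ → [0, ∞)` is log-concave: `f = exp (-v)` with `v` convex and
`(-∞, ∞]`-valued, written multiplicatively so that `f` may vanish. -/
structure IsLogConcave {n : ℕ} (f : EuclideanSpace ℝ (Fin n) → ℝ) : Prop where
  nonneg : ∀ x, 0 ≤ f x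
  rpow_mul_rpow_le : ∀ x y : EuclideanSpace ℝ (Fin n), ∀ a b : ℝ, 0 < a → 0 < b → a + b = 1 →
    f x ^ a * f y ^ b ≤ f (a • x + b • y)

/-- The subspace spanned by the vectors `w k`, `k ∈ A`. -/
def spanOn {n : ℕ} (w : Fin n → EuclideanSpace ℝ (Fin n)) (A : Finset (Fin n)) :
    Submodule ℝ (EuclideanSpace ℝ (Fin n)) :=
  Submodule.span ℝ (w '' (A : Set (Fin n)))

/-- `|⋀_{k ∈ A} w k|`: the volume of the parallelepiped spanned by the vectors `w k`, `k ∈ A`,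
with respect to Lebesgue measure on the subspace that they span
(for linearly independent vectors, this is the `#A`-dimensional volume; it is `1` for `A = ∅`). -/
noncomputable def wedgeVol {n : ℕ} (w : Fin n → EuclideanSpace ℝ (Fin n)) (A : Finset (Fin n)) :
    ℝ :=
  (volume {x : spanOn w A |
    (x : EuclideanSpace ℝ (Fin n)) ∈ parallelepiped (fun k : A => w k)}).toReal

/-- The projection of `f ≥ 0` onto the subspace `F`: `P_F f (x) = sup_{y ∈ Fᗮ} f (x + y)`,
`x ∈ F`, with the supremum taken in `[0, ∞]`. -/
noncomputable def projFun {n : ℕ} (F : Submodule ℝ (EuclideanSpace ℝ (Fin n)))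
    (f : EuclideanSpace ℝ (Fin n) → ℝ) (x : F) : ℝ≥0∞ :=
  ⨆ y : Fᗮ, ENNReal.ofReal (f ((x : EuclideanSpace ℝ (Fin n)) + (y : EuclideanSpace ℝ (Fin n))))

/-- `‖P_F f‖₁`: the integral of `P_F f` with respect to Lebesgue measure on the subspace `F`. -/
noncomputable def projNorm {n : ℕ} (F : Submodule ℝ (EuclideanSpace ℝ (Fin n)))
    (f : EuclideanSpace ℝ (Fin n) → ℝ) : ℝ≥0∞ :=
  ∫⁻ x : F, projFun F f x

/-! Everything reduces to one inequality in coordinates. Let f be log-concave on ℝ^d × Z, put M(z) =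
sup_x f(x, z) and L = ∫ M, let the T_j, with d_j elements and weights q_j of sum p, cover the d
coordinates uniformly, and let N_j be the integral of the projection of f to ℝ^{T_j} × Z. Then
L^{p-1} ∫ f ≤ d! ∏ (N_j / d_j!)^{q_j}; this is `fibreSup_rpow_mul_lintegral_le`.

To prove it, slice at height e^{-r}. The density e^{-r} on the region e^{-r} < M(z) is log-concave
in (z, r) and has mass L. Against it, ∫ f is the integral of the volume of the slice {x : f(x, z) >
e^{-r}}, and N_j is the integral of the volume V_j of the projected slice. The Bollobás–Thomason
inequality bounds the slice by ∏ V_j^{q_j}, and Hölder with exponents q_j d_j / d, which sum to 1,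
leaves the integrals of V_j^{d/d_j}. By Brunn–Minkowski V_j^{1/d_j} is concave, so Borell's reverse
Hölder inequality bounds its d-th moment by its d_j-th moment N_j; the gamma factors are d! and
d_j!. Brunn–Minkowski and Borell both rest on Prékopa–Leindler.

The coordinates are x ↦ ⟪u_i, x⟫ for a basis u: projecting f onto the span of the u_i, i ∈ A,
amounts to keeping the coordinates in A, with a Jacobian that is the root of a Gram determinant. The
dual basis of w gives the first inequality, since its span over Bᶜ is the orthogonal complement of
the span of w over B, and Jacobi's minor formula converts the volumes. The vectors w_k, k ∈ S,
completed by an orthonormal basis of H^⊥, give the third. The second and fourth are the first and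
third for the cover S \ T_j with weights q_j / (p-1), raised to the power p-1. The cases p = 1 and S
= ∅ are direct. -/

/-- Log-concavity of a `[0, ∞]`-valued function. -/
def ENNLogConcave {E : Type*} [AddCommMonoid E] [Module ℝ E] (f : E → ℝ≥0∞) : Prop :=
  ∀ x y : E, ∀ a b : ℝ, 0 < a → 0 < b → a + b = 1 → f x ^ a * f y ^ b ≤ f (a • x + b • y)

/-! ### Weighted means and suprema in [0, ∞] -/

lemma ennreal_rpow_mul_rpow_self {a b : ℝ} (ha : 0 ≤ a) (hb : 0 ≤ b) (hab : a + b = 1)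
    (t : ℝ≥0∞) : t ^ a * t ^ b = t := by
  rw [← ENNReal.rpow_add_of_nonneg _ _ ha hb, hab, ENNReal.rpow_one]

lemma ennreal_geom_mean_le_arith_mean {a b : ℝ} (ha : 0 < a) (hb : 0 < b) (hab : a + b = 1)
    (x y : ℝ≥0∞) : x ^ a * y ^ b ≤ ENNReal.ofReal a * x + ENNReal.ofReal b * y := by
  have ha' : ENNReal.ofReal a ≠ 0 := by simpa using ha
  have hb' : ENNReal.ofReal b ≠ 0 := by simpa using hb
  induction x with
  | top => simp [ENNReal.mul_top ha']
  | coe x =>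
    induction y with
    | top => simp [ENNReal.mul_top hb']
    | coe y =>
      have := NNReal.geom_mean_le_arith_mean2_weighted a.toNNReal b.toNNReal x y
        (by rw [← Real.toNNReal_add ha.le hb.le, hab, Real.toNNReal_one])
      rw [← ENNReal.coe_rpow_of_nonneg _ ha.le, ← ENNReal.coe_rpow_of_nonneg _ hb.le]
      rw [Real.coe_toNNReal a ha.le, Real.coe_toNNReal b hb.le] at this
      rw [ENNReal.ofReal, ENNReal.ofReal]
      exact_mod_cast this

lemma ENNReal.iSup_mul_iSup_of_monotone_nat {u v : ℕ → ℝ≥0∞} (hu : Monotone u)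
    (hv : Monotone v) : (⨆ k, u k) * (⨆ k, v k) = ⨆ k, u k * v k := by
  apply le_antisymm
  · rw [ENNReal.iSup_mul]
    refine iSup_le fun i => ?_
    rw [ENNReal.mul_iSup]
    refine iSup_le fun j => ?_
    exact (mul_le_mul' (hu (le_max_left i j)) (hv (le_max_right i j))).trans
      (le_iSup (fun k => u k * v k) (max i j))
  · exact ENNReal.iSup_mul_le

lemma ENNReal.iSup_rpow_of_pos {ι : Sort*} (u : ι → ℝ≥0∞) {a : ℝ} (ha : 0 < a) :
    (⨆ k, u k) ^ a = ⨆ k, u k ^ a :=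
  (ENNReal.orderIsoRpow a ha).map_iSup u

lemma ENNReal.iSup_rpow_of_nonneg {ι : Sort*} [Nonempty ι] (u : ι → ℝ≥0∞) {a : ℝ} (ha : 0 ≤ a) :
    (⨆ k, u k) ^ a = ⨆ k, u k ^ a := by
  rcases ha.eq_or_lt with rfl | ha
  · simp
  · exact ENNReal.iSup_rpow_of_pos u ha

lemma ENNReal.iSup_min_natCast (x : ℝ≥0∞) : ⨆ k : ℕ, min x (k : ℝ≥0∞) = x := by
  rw [← inf_iSup_eq, ENNReal.iSup_natCast, inf_top_eq]

/-! ### Log-concave functions and suprema over fibres -/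

section LogConcave

variable {E F : Type*} [AddCommGroup E] [Module ℝ E] [AddCommGroup F] [Module ℝ F]

lemma ENNLogConcave.convex_superlevel {f : E → ℝ≥0∞} (hf : ENNLogConcave f) (t : ℝ≥0∞) :
    Convex ℝ {x | t < f x} := by
  rw [convex_iff_forall_pos]
  intro x hx y hy a b ha hb hab
  refine lt_of_lt_of_le ?_ (hf x y a b ha hb hab)
  rw [← ennreal_rpow_mul_rpow_self ha.le hb.le hab t]
  exact ENNReal.mul_lt_mul (ENNReal.rpow_lt_rpow hx ha) (ENNReal.rpow_lt_rpow hy hb)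

lemma ENNLogConcave.comp_linearMap {f : F → ℝ≥0∞} (hf : ENNLogConcave f) (L : E →ₗ[ℝ] F) :
    ENNLogConcave fun x => f (L x) := by
  intro x y a b ha hb hab
  simpa using hf (L x) (L y) a b ha hb hab

lemma ENNLogConcave.min_const {f : E → ℝ≥0∞} (hf : ENNLogConcave f) (c : ℝ≥0∞) :
    ENNLogConcave fun x => min (f x) c := by
  intro x y a b ha hb hab
  refine le_min ?_ ?_
  · refine le_trans ?_ (hf x y a b ha hb hab)
    gcongr <;> exact min_le_left _ _
  · conv_rhs => rw [← ennreal_rpow_mul_rpow_self ha.le hb.le hab c]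
    gcongr <;> exact min_le_right _ _

lemma ENNLogConcave.indicator {f : E → ℝ≥0∞} (hf : ENNLogConcave f) {K : Set E}
    (hK : Convex ℝ K) : ENNLogConcave (K.indicator f) := by
  intro x y a b ha hb hab
  by_cases hx : x ∈ K
  · by_cases hy : y ∈ K
    · rw [Set.indicator_of_mem hx, Set.indicator_of_mem hy,
        Set.indicator_of_mem (hK hx hy ha.le hb.le hab)]
      exact hf x y a b ha hb hab
    · rw [Set.indicator_of_notMem hy, ENNReal.zero_rpow_of_pos hb, mul_zero]
      exact zero_le
  · rw [Set.indicator_of_notMem hx, ENNReal.zero_rpow_of_pos ha, zero_mul]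
    exact zero_le

lemma ENNLogConcave.const (c : ℝ≥0∞) : ENNLogConcave fun _ : E => c := by
  intro x y a b ha hb hab
  exact (ennreal_rpow_mul_rpow_self ha.le hb.le hab c).le

/-- The supremum of `f` over the fibres of `π`. -/
noncomputable def supFiber {X Y : Type*} (π : X → Y) (f : X → ℝ≥0∞) (y : Y) : ℝ≥0∞ :=
  ⨆ x : {x // π x = y}, f x

lemma lt_supFiber_iff {X Y : Type*} {π : X → Y} {f : X → ℝ≥0∞} {y : Y} {t : ℝ≥0∞} :
    t < supFiber π f y ↔ ∃ x, π x = y ∧ t < f x := by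
  simp [supFiber, lt_iSup_iff]

lemma le_supFiber {X Y : Type*} (π : X → Y) (f : X → ℝ≥0∞) (x : X) :
    f x ≤ supFiber π f (π x) :=
  le_iSup (fun z : {z // π z = π x} => f z) ⟨x, rfl⟩

lemma supFiber_le_iff {X Y : Type*} {π : X → Y} {f : X → ℝ≥0∞} {y : Y} {t : ℝ≥0∞} :
    supFiber π f y ≤ t ↔ ∀ x, π x = y → f x ≤ t := by
  simp [supFiber]

lemma supFiber_iSup {X Y ι : Type*} (π : X → Y) (f : ι → X → ℝ≥0∞) (y : Y) :
    supFiber π (fun x => ⨆ k, f k x) y = ⨆ k, supFiber π (f k) y := by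
  rw [supFiber, iSup_comm]
  rfl

lemma supFiber_mono {X Y : Type*} (π : X → Y) {f g : X → ℝ≥0∞} (h : ∀ x, f x ≤ g x) (y : Y) :
    supFiber π f y ≤ supFiber π g y :=
  iSup_mono fun x => h x

/-- A convex combination of points of two fibres lies in the fibre over the combined point, so the
inequality for `f` passes to the suprema. -/
lemma ENNLogConcave.supFiber {f : E → ℝ≥0∞} (hf : ENNLogConcave f) (π : E →ₗ[ℝ] F) :
    ENNLogConcave (supFiber π f) := by
  intro x y a b ha hb hab
  unfold _root_.supFiber
  rw [ENNReal.iSup_rpow_of_pos _ ha, ENNReal.iSup_rpow_of_pos _ hb, ENNReal.iSup_mul]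
  refine iSup_le fun u => ?_
  rw [ENNReal.mul_iSup]
  refine iSup_le fun v => ?_
  refine (hf u v a b ha hb hab).trans ?_
  exact le_iSup (fun z : {z // π z = a • x + b • y} => f z)
    ⟨a • u + b • v, by simp [u.2, v.2]⟩

end LogConcave

/-! ### Log-concave functions are a.e. measurable -/

section Measurability

variable {E : Type*} [NormedAddCommGroup E] [NormedSpace ℝ E] [FiniteDimensional ℝ E]
  [MeasurableSpace E] [BorelSpace E] (μ : Measure E) [μ.IsAddHaarMeasure]

/-- The frontier of a convex set is Haar-null. This is what lets all later integrals do without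
measurability hypotheses. -/
lemma Convex.nullMeasurableSet_addHaar {s : Set E} (hs : Convex ℝ s) :
    NullMeasurableSet s μ :=
  nullMeasurableSet_of_null_frontier (hs.addHaar_frontier μ)

lemma aemeasurable_of_convex_superlevel {f : E → ℝ≥0∞} (hf : ∀ t, Convex ℝ {x | t < f x}) :
    AEMeasurable f μ := by
  apply NullMeasurable.aemeasurable
  have : @Measurable (NullMeasurableSpace E μ) _ _ _ f :=
    measurable_of_Ioi fun t => (hf t).nullMeasurableSet_addHaar μ
  exact this

lemma ENNLogConcave.aemeasurable {f : E → ℝ≥0∞} (hf : ENNLogConcave f) : AEMeasurable f μ :=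
  aemeasurable_of_convex_superlevel μ hf.convex_superlevel

lemma ENNLogConcave.measurable_real {f : ℝ → ℝ≥0∞} (hf : ENNLogConcave f) : Measurable f :=
  measurable_of_Ioi fun t => (hf.convex_superlevel t).ordConnected.measurableSet

end Measurability

/-! ### The Prékopa–Leindler inequality on the line -/

section OneDim

/-- One-dimensional Brunn–Minkowski. As `L` is an interval, it contains everything between two
combinations of points of `I` and `J`, so only the diameters of `I` and `J` matter. -/
lemma Real.volume_add_le_of_ordConnected {I J L : Set ℝ} (hL : L.OrdConnected)
    (hI : I.Nonempty) (hJ : J.Nonempty) {a b : ℝ} (ha : 0 ≤ a) (hb : 0 ≤ b)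
    (h : ∀ x ∈ I, ∀ y ∈ J, a * x + b * y ∈ L) :
    ENNReal.ofReal a * volume I + ENNReal.ofReal b * volume J ≤ volume L := by
  have key : ∀ I : Set ℝ, volume I ≤ ⨆ p : I × I, ENNReal.ofReal (p.2 - p.1) := by
    intro I
    refine (Real.volume_le_diam I).trans ?_
    refine Metric.ediam_le fun x hx y hy => ?_
    rw [edist_dist, Real.dist_eq]
    rcases le_total x y with hxy | hxy
    · rw [abs_sub_comm, abs_of_nonneg (sub_nonneg.2 hxy)]
      exact le_iSup (fun p : I × I => ENNReal.ofReal ((p.2 : ℝ) - p.1)) (⟨x, hx⟩, ⟨y, hy⟩)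
    · rw [abs_of_nonneg (sub_nonneg.2 hxy)]
      exact le_iSup (fun p : I × I => ENNReal.ofReal ((p.2 : ℝ) - p.1)) (⟨y, hy⟩, ⟨x, hx⟩)
  have : Nonempty I := hI.to_subtype
  have : Nonempty J := hJ.to_subtype
  refine (add_le_add (mul_le_mul_right (key I) _) (mul_le_mul_right (key J) _)).trans ?_
  rw [ENNReal.mul_iSup, ENNReal.mul_iSup]
  refine ENNReal.iSup_add_iSup_le fun p r => ?_
  rw [← ENNReal.ofReal_mul ha, ← ENNReal.ofReal_mul hb]
  have hsub : ∀ (x x' y y' : ℝ), x ∈ I → x' ∈ I → y ∈ J → y' ∈ J →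
      ENNReal.ofReal ((a * x' + b * y') - (a * x + b * y)) ≤ volume L := by
    intro x x' y y' hx hx' hy hy'
    rw [← Real.volume_Icc]
    exact measure_mono (hL.out (h x hx y hy) (h x' hx' y' hy'))
  obtain ⟨⟨x, hx⟩, ⟨x', hx'⟩⟩ := p
  obtain ⟨⟨y, hy⟩, ⟨y', hy'⟩⟩ := r
  dsimp only
  -- A pair in the wrong order contributes `ofReal` of a nonpositive number, that is 0, and is
  -- replaced by a constant pair.
  rcases le_total x x' with hxx | hxx <;> rcases le_total y y' with hyy | hyy
  · rw [← ENNReal.ofReal_add (by nlinarith [mul_nonneg ha (sub_nonneg.2 hxx)])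
      (by nlinarith [mul_nonneg hb (sub_nonneg.2 hyy)])]
    convert hsub x x' y y' hx hx' hy hy' using 2; ring
  · rw [ENNReal.ofReal_of_nonpos (p := b * (y' - y))
      (mul_nonpos_of_nonneg_of_nonpos hb (sub_nonpos.2 hyy)), add_zero]
    convert hsub x x' y y hx hx' hy hy using 2; ring
  · rw [ENNReal.ofReal_of_nonpos (p := a * (x' - x))
      (mul_nonpos_of_nonneg_of_nonpos ha (sub_nonpos.2 hxx)), zero_add]
    convert hsub x x y y' hx hx hy hy' using 2; ring
  · rw [ENNReal.ofReal_of_nonpos (p := b * (y' - y))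
      (mul_nonpos_of_nonneg_of_nonpos hb (sub_nonpos.2 hyy)),
      ENNReal.ofReal_of_nonpos (p := a * (x' - x))
      (mul_nonpos_of_nonneg_of_nonpos ha (sub_nonpos.2 hxx)), zero_add]
    exact zero_le

lemma volume_setOf_pos_ofReal_lt (y : ℝ≥0∞) :
    volume {t : ℝ | 0 < t ∧ ENNReal.ofReal t < y} = y := by
  induction y with
  | top =>
    have : {t : ℝ | 0 < t ∧ ENNReal.ofReal t < ⊤} = Set.Ioi 0 := by ext t; simp
    rw [this, Real.volume_Ioi]
  | coe y =>
    have : {t : ℝ | 0 < t ∧ ENNReal.ofReal t < y} = Set.Ioo 0 (y : ℝ) := by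
      ext t
      simp only [Set.mem_ofPred_eq, Set.mem_Ioo, and_congr_right_iff]
      intro ht
      rw [← ENNReal.ofReal_coe_nnreal, ENNReal.ofReal_lt_ofReal_iff_of_nonneg ht.le]
    rw [this, Real.volume_Ioo, sub_zero, ENNReal.ofReal_coe_nnreal]

/-- Layer cake for `[0, ∞]`-valued functions: Tonelli on the region under the graph. -/
lemma lintegral_eq_lintegral_meas_ofReal_lt {α : Type*} [MeasurableSpace α] (μ : Measure α)
    [SFinite μ] {f : α → ℝ≥0∞} (hf : Measurable f) :
    ∫⁻ x, f x ∂μ = ∫⁻ t in Set.Ioi (0 : ℝ), μ {x | ENNReal.ofReal t < f x} := by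
  have hm : MeasurableSet {p : α × ℝ | 0 < p.2 ∧ ENNReal.ofReal p.2 < f p.1} :=
    (measurableSet_lt measurable_const measurable_snd).inter
      (measurableSet_lt (ENNReal.measurable_ofReal.comp measurable_snd) (hf.comp measurable_fst))
  have h1 := Measure.prod_apply (μ := μ) (ν := (volume : Measure ℝ)) hm
  have h2 := Measure.prod_apply_symm (μ := μ) (ν := (volume : Measure ℝ)) hm
  rw [h1] at h2
  have h3 : ∀ x, volume (Prod.mk x ⁻¹' {p : α × ℝ | 0 < p.2 ∧ ENNReal.ofReal p.2 < f p.1})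
      = f x := fun x => volume_setOf_pos_ofReal_lt (f x)
  simp_rw [h3] at h2
  rw [h2, ← lintegral_indicator measurableSet_Ioi]
  congr 1
  ext t
  by_cases ht : 0 < t
  · rw [Set.indicator_of_mem (Set.mem_Ioi.2 ht)]
    congr 1
    ext x
    simp [ht]
  · rw [Set.indicator_of_notMem (by simpa using ht)]
    convert measure_empty (μ := μ)
    ext x
    simp [ht]

/-- With both suprema equal to 1, the superlevel sets of `f` and `g` at a height below 1 are both
nonempty, so one-dimensional Brunn–Minkowski applies to each height; at heights from 1 on they are
both empty. -/
lemma prekopa_leindler_one_dim_normalized {f g h : ℝ → ℝ≥0∞} (hf : Measurable f)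
    (hg : Measurable g) (hh : Measurable h) (hc : ∀ t, {x | t < h x}.OrdConnected)
    {a b : ℝ} (ha : 0 < a) (hb : 0 < b) (hab : a + b = 1)
    (hle : ∀ x y, f x ^ a * g y ^ b ≤ h (a * x + b * y))
    (hf1 : ⨆ x, f x = 1) (hg1 : ⨆ x, g x = 1) :
    ENNReal.ofReal a * (∫⁻ x, f x) + ENNReal.ofReal b * (∫⁻ x, g x) ≤ ∫⁻ x, h x := by
  have hmono : ∀ f : ℝ → ℝ≥0∞, Measurable fun t : ℝ => volume {x | ENNReal.ofReal t < f x} := by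
    intro f
    refine Antitone.measurable fun s t hst => measure_mono fun x hx => ?_
    exact lt_of_le_of_lt (ENNReal.ofReal_le_ofReal hst) hx
  rw [lintegral_eq_lintegral_meas_ofReal_lt _ hf, lintegral_eq_lintegral_meas_ofReal_lt _ hg,
    lintegral_eq_lintegral_meas_ofReal_lt _ hh, ← lintegral_const_mul _ (hmono f),
    ← lintegral_const_mul _ (hmono g),
    ← lintegral_add_left ((hmono f).const_mul _)]
  refine setLIntegral_mono (hmono h) fun t ht => ?_
  by_cases ht1 : ENNReal.ofReal t < 1
  · refine Real.volume_add_le_of_ordConnected (hc _) ?_ ?_ ha.le hb.le ?_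
    · rw [← hf1, lt_iSup_iff] at ht1; exact ht1
    · rw [← hg1, lt_iSup_iff] at ht1; exact ht1
    · intro x hx y hy
      refine lt_of_lt_of_le ?_ (hle x y)
      rw [← ennreal_rpow_mul_rpow_self ha.le hb.le hab (ENNReal.ofReal t)]
      exact ENNReal.mul_lt_mul (ENNReal.rpow_lt_rpow hx ha) (ENNReal.rpow_lt_rpow hy hb)
  · have hz : ∀ f : ℝ → ℝ≥0∞, ⨆ x, f x = 1 → {x | ENNReal.ofReal t < f x} = ∅ := by
      intro f hf
      ext x
      simp only [Set.mem_ofPred_eq, Set.mem_empty_iff_false, iff_false, not_lt]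
      exact (le_iSup f x).trans (hf.le.trans (not_lt.1 ht1))
    rw [hz f hf1, hz g hg1]
    simp

/-- Dividing `f`, `g`, `h` by `α`, `β`, `α ^ a * β ^ b` preserves the hypothesis and normalizes the
suprema; the weighted AM–GM inequality then turns the additive bound into the multiplicative one. -/
lemma prekopa_leindler_one_dim_bounded {f g h : ℝ → ℝ≥0∞} (hf : Measurable f)
    (hg : Measurable g) (hh : Measurable h) (hc : ∀ t, {x | t < h x}.OrdConnected)
    {a b : ℝ} (ha : 0 < a) (hb : 0 < b) (hab : a + b = 1)
    (hle : ∀ x y, f x ^ a * g y ^ b ≤ h (a * x + b * y))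
    (hf1 : ⨆ x, f x ≠ ⊤) (hg1 : ⨆ x, g x ≠ ⊤) :
    (∫⁻ x, f x) ^ a * (∫⁻ x, g x) ^ b ≤ ∫⁻ x, h x := by
  set α := ⨆ x, f x with hα
  set β := ⨆ x, g x with hβ
  by_cases hα0 : α = 0
  · have : ∀ x, f x = 0 := fun x => le_antisymm ((le_iSup f x).trans hα0.le) zero_le
    simp [this, ha]
  by_cases hβ0 : β = 0
  · have : ∀ x, g x = 0 := fun x => le_antisymm ((le_iSup g x).trans hβ0.le) zero_le
    simp [this, hb]
  have hαa : α ^ a ≠ 0 := by simp [ENNReal.rpow_eq_zero_iff, hα0, hf1]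
  have hβb : β ^ b ≠ 0 := by simp [ENNReal.rpow_eq_zero_iff, hβ0, hg1]
  have hαa' : α ^ a ≠ ⊤ := ENNReal.rpow_ne_top_of_nonneg ha.le hf1
  have hβb' : β ^ b ≠ ⊤ := ENNReal.rpow_ne_top_of_nonneg hb.le hg1
  have hγ0 : α ^ a * β ^ b ≠ 0 := mul_ne_zero hαa hβb
  have hγ1 : α ^ a * β ^ b ≠ ⊤ := ENNReal.mul_ne_top hαa' hβb'
  have key := prekopa_leindler_one_dim_normalized (f := fun x => α⁻¹ * f x)
    (g := fun x => β⁻¹ * g x) (h := fun x => (α ^ a * β ^ b)⁻¹ * h x) (hf.const_mul _)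
    (hg.const_mul _) (hh.const_mul _) (fun t => by
      convert hc ((α ^ a * β ^ b) * t) using 3 with x
      rw [mul_comm _ (h x), ← div_eq_mul_inv, ENNReal.lt_div_iff_mul_lt (.inl hγ0) (.inl hγ1),
        mul_comm]) ha hb hab (fun x y => by
      rw [ENNReal.mul_rpow_of_nonneg _ _ ha.le, ENNReal.mul_rpow_of_nonneg _ _ hb.le,
        ENNReal.inv_rpow, ENNReal.inv_rpow, ENNReal.mul_inv (.inl hαa) (.inl hαa')]
      calc _ = (α ^ a)⁻¹ * (β ^ b)⁻¹ * (f x ^ a * g y ^ b) := by ring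
        _ ≤ _ := by gcongr; exact hle x y)
      (by rw [← ENNReal.mul_iSup, ← hα, ENNReal.inv_mul_cancel hα0 hf1])
      (by rw [← ENNReal.mul_iSup, ← hβ, ENNReal.inv_mul_cancel hβ0 hg1])
  rw [lintegral_const_mul _ hf, lintegral_const_mul _ hg, lintegral_const_mul _ hh] at key
  have key2 := (ennreal_geom_mean_le_arith_mean ha hb hab _ _).trans key
  rw [ENNReal.mul_rpow_of_nonneg _ _ ha.le, ENNReal.mul_rpow_of_nonneg _ _ hb.le,
    ENNReal.inv_rpow, ENNReal.inv_rpow, ENNReal.mul_inv (.inl hαa) (.inl hαa')] at key2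
  have key3 := mul_le_mul_right key2 (α ^ a * β ^ b)
  calc (∫⁻ x, f x) ^ a * (∫⁻ x, g x) ^ b
      = (α ^ a * (α ^ a)⁻¹) * (β ^ b * (β ^ b)⁻¹) * ((∫⁻ x, f x) ^ a * (∫⁻ x, g x) ^ b) := by
        rw [ENNReal.mul_inv_cancel hαa hαa', ENNReal.mul_inv_cancel hβb hβb', one_mul, one_mul]
    _ = α ^ a * β ^ b * ((α ^ a)⁻¹ * (∫⁻ x, f x) ^ a * ((β ^ b)⁻¹ * (∫⁻ x, g x) ^ b)) := by ring
    _ ≤ _ := key3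
    _ = (α ^ a * (α ^ a)⁻¹) * (β ^ b * (β ^ b)⁻¹) * ∫⁻ x, h x := by ring
    _ = _ := by
        rw [ENNReal.mul_inv_cancel hαa hαa', ENNReal.mul_inv_cancel hβb hβb', one_mul, one_mul]

lemma prekopa_leindler_one_dim {f g h : ℝ → ℝ≥0∞} (hf : Measurable f)
    (hg : Measurable g) (hh : Measurable h) (hc : ∀ t, {x | t < h x}.OrdConnected)
    {a b : ℝ} (ha : 0 < a) (hb : 0 < b) (hab : a + b = 1)
    (hle : ∀ x y, f x ^ a * g y ^ b ≤ h (a * x + b * y)) :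
    (∫⁻ x, f x) ^ a * (∫⁻ x, g x) ^ b ≤ ∫⁻ x, h x := by
  have htrunc : ∀ f : ℝ → ℝ≥0∞, Measurable f →
      ∫⁻ x, f x = ⨆ k : ℕ, ∫⁻ x, min (f x) (k : ℝ≥0∞) := by
    intro f hf
    rw [← lintegral_iSup (fun k => hf.min measurable_const)
      (fun i j hij x => min_le_min_left _ (by exact_mod_cast hij))]
    simp_rw [ENNReal.iSup_min_natCast]
  have hmono : ∀ f : ℝ → ℝ≥0∞, Monotone fun k : ℕ => ∫⁻ x, min (f x) (k : ℝ≥0∞) :=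
    fun f i j hij => lintegral_mono fun x => min_le_min_left _ (by exact_mod_cast hij)
  rw [htrunc f hf, htrunc g hg, ENNReal.iSup_rpow_of_pos _ ha, ENNReal.iSup_rpow_of_pos _ hb,
    ENNReal.iSup_mul_iSup_of_monotone_nat
      (fun i j hij => ENNReal.rpow_le_rpow (hmono f hij) ha.le)
      (fun i j hij => ENNReal.rpow_le_rpow (hmono g hij) hb.le)]
  refine iSup_le fun k => ?_
  refine prekopa_leindler_one_dim_bounded (hf.min measurable_const) (hg.min measurable_const)
    hh hc ha hb hab (fun x y => le_trans ?_ (hle x y)) ?_ ?_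
  · gcongr <;> exact min_le_left _ _
  · exact ne_top_of_le_ne_top (ENNReal.natCast_ne_top k) (iSup_le fun x => min_le_right _ _)
  · exact ne_top_of_le_ne_top (ENNReal.natCast_ne_top k) (iSup_le fun x => min_le_right _ _)

end OneDim

/-! ### The Prékopa–Leindler inequality in finite dimension -/

section PrekopaLeindler

variable {E F : Type*} [NormedAddCommGroup E] [NormedSpace ℝ E] [FiniteDimensional ℝ E]
  [MeasurableSpace E] [BorelSpace E] [NormedAddCommGroup F] [NormedSpace ℝ F]
  [FiniteDimensional ℝ F] [MeasurableSpace F] [BorelSpace F]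

/-- The Prékopa–Leindler inequality for triples of log-concave functions. -/
def PrekopaLeindler (μ : Measure E) : Prop :=
  ∀ f g h : E → ℝ≥0∞, ENNLogConcave f → ENNLogConcave g → ENNLogConcave h →
    ∀ a b : ℝ, 0 < a → 0 < b → a + b = 1 →
    (∀ x y, f x ^ a * g y ^ b ≤ h (a • x + b • y)) →
    (∫⁻ x, f x ∂μ) ^ a * (∫⁻ x, g x ∂μ) ^ b ≤ ∫⁻ x, h x ∂μ

lemma PrekopaLeindler.real : PrekopaLeindler (volume : Measure ℝ) :=
  fun _ _ _ hf hg hh _ _ ha hb hab hle =>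
    prekopa_leindler_one_dim hf.measurable_real hg.measurable_real hh.measurable_real
      (fun t => (hh.convex_superlevel t).ordConnected) ha hb hab hle

lemma PrekopaLeindler.logConcave_lintegral {ν : Measure F} (hν : PrekopaLeindler ν)
    {f : E × F → ℝ≥0∞} (hf : ENNLogConcave f) : ENNLogConcave fun x => ∫⁻ y, f (x, y) ∂ν := by
  have hsec : ∀ x, ENNLogConcave fun y => f (x, y) := by
    intro x y y' a b ha hb hab
    have := hf (x, y) (x, y') a b ha hb hab
    rwa [Prod.smul_mk, Prod.smul_mk, Prod.mk_add_mk, ← add_smul, hab, one_smul] at this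
  intro x x' a b ha hb hab
  exact hν _ _ _ (hsec _) (hsec _) (hsec _) a b ha hb hab fun y y' =>
    hf (x, y) (x', y') a b ha hb hab

/-- The inequality for `ν` on the sections provides the hypothesis of the inequality for `μ` on the
marginals, which are themselves log-concave by the same inequality for `ν`. -/
lemma PrekopaLeindler.prod {μ : Measure E} {ν : Measure F} [μ.IsAddHaarMeasure]
    [ν.IsAddHaarMeasure] (hμ : PrekopaLeindler μ) (hν : PrekopaLeindler ν) :
    PrekopaLeindler (μ.prod ν) := by
  intro f g h hf hg hh a b ha hb hab hle
  have hsec : ∀ f : E × F → ℝ≥0∞, ENNLogConcave f → ∀ x, ENNLogConcave fun y => f (x, y) := by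
    intro f hf x y y' a b ha hb hab
    have := hf (x, y) (x, y') a b ha hb hab
    rwa [Prod.smul_mk, Prod.smul_mk, Prod.mk_add_mk, ← add_smul, hab, one_smul] at this
  rw [lintegral_prod _ (hf.aemeasurable _), lintegral_prod _ (hg.aemeasurable _),
    lintegral_prod _ (hh.aemeasurable _)]
  refine hμ _ _ _ (hν.logConcave_lintegral hf) (hν.logConcave_lintegral hg)
    (hν.logConcave_lintegral hh) a b ha hb hab fun x x' => ?_
  exact hν _ _ _ (hsec f hf x) (hsec g hg x') (hsec h hh _) a b ha hb hab fun y y' =>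
    hle (x, y) (x', y')

/-- The image of `μ` is a constant multiple `c` of `ν`, and both sides are homogeneous of the same
degree in `c` because `c ^ a * c ^ b = c`. -/
lemma PrekopaLeindler.of_equiv {μ : Measure E} {ν : Measure F} [μ.IsAddHaarMeasure]
    [ν.IsAddHaarMeasure] (hν : PrekopaLeindler ν) (e : E ≃L[ℝ] F) : PrekopaLeindler μ := by
  intro f g h hf hg hh a b ha hb hab hle
  have := e.isAddHaarMeasure_map μ
  obtain ⟨c, hc⟩ : ∃ c : NNReal, μ.map e = c • ν :=
    ⟨_, Measure.isAddLeftInvariant_eq_smul (μ.map e) ν⟩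
  have hint : ∀ f : E → ℝ≥0∞, ∫⁻ x, f x ∂μ = c * ∫⁻ y, f (e.symm y) ∂ν := by
    intro f
    have h1 := lintegral_map_equiv (μ := μ) (fun y => f (e.symm y))
      e.toHomeomorph.toMeasurableEquiv
    have h2 : μ.map e.toHomeomorph.toMeasurableEquiv = c • ν := hc
    rw [h2, lintegral_smul_measure] at h1
    have h3 : ∀ x, e.symm (e.toHomeomorph.toMeasurableEquiv x) = x := fun x =>
      e.symm_apply_apply x
    simp_rw [h3] at h1
    exact h1.symm
  have hlc : ∀ f : E → ℝ≥0∞, ENNLogConcave f → ENNLogConcave fun y => f (e.symm y) :=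
    fun f hf => hf.comp_linearMap e.symm.toLinearEquiv.toLinearMap
  rw [hint, hint, hint, ENNReal.mul_rpow_of_nonneg _ _ ha.le, ENNReal.mul_rpow_of_nonneg _ _ hb.le,
    mul_mul_mul_comm, ennreal_rpow_mul_rpow_self ha.le hb.le hab]
  gcongr
  refine hν _ _ _ (hlc f hf) (hlc g hg) (hlc h hh) a b ha hb hab fun x y => ?_
  simpa using hle (e.symm x) (e.symm y)

lemma PrekopaLeindler.pi (n : ℕ) : PrekopaLeindler (volume : Measure (Fin n → ℝ)) := by
  induction n with
  | zero =>
    intro f g h hf hg hh a b ha hb hab hle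
    simp only [lintegral_unique]
    have h1 : (volume : Measure (Fin 0 → ℝ)) Set.univ = 1 := by
      simp [volume_pi]
    rw [h1, mul_one, mul_one, mul_one]
    have h2 := hle 0 0
    rw [Subsingleton.elim (a • (0 : Fin 0 → ℝ) + b • 0) 0] at h2
    exact h2.trans' (le_of_eq (by congr 3 <;> exact Subsingleton.elim _ _)) |>.trans
      (le_of_eq (by congr 1; exact Subsingleton.elim _ _))
  | succ n ih =>
    exact (PrekopaLeindler.real.prod ih).of_equiv
      (ContinuousLinearEquiv.ofFinrankEq (by simp [add_comm]))

lemma prekopaLeindler_addHaar (μ : Measure E) [μ.IsAddHaarMeasure] : PrekopaLeindler μ :=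
  (PrekopaLeindler.pi (Module.finrank ℝ E)).of_equiv
    (ContinuousLinearEquiv.ofFinrankEq (by simp))

end PrekopaLeindler

/-! ### The Brunn–Minkowski inequality for convex sets -/

section BrunnMinkowski

open scoped Pointwise

variable {E : Type*} [NormedAddCommGroup E] [NormedSpace ℝ E] [FiniteDimensional ℝ E]
  [MeasurableSpace E] [BorelSpace E] (μ : Measure E) [μ.IsAddHaarMeasure]

/-- The multiplicative Brunn–Minkowski inequality for convex sets. -/
lemma Convex.measure_rpow_mul_measure_rpow_le {K₀ K₁ L : Set E} (h₀ : Convex ℝ K₀)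
    (h₁ : Convex ℝ K₁) (hL : Convex ℝ L) {a b : ℝ} (ha : 0 < a) (hb : 0 < b) (hab : a + b = 1)
    (h : ∀ x ∈ K₀, ∀ y ∈ K₁, a • x + b • y ∈ L) :
    μ K₀ ^ a * μ K₁ ^ b ≤ μ L := by
  have hlc : ∀ K : Set E, Convex ℝ K → ENNLogConcave (K.indicator (1 : E → ℝ≥0∞)) :=
    fun K hK => (ENNLogConcave.const 1).indicator hK
  have key := prekopaLeindler_addHaar μ _ _ _ (hlc _ h₀) (hlc _ h₁) (hlc _ hL) a b ha hb hab
    (fun x y => by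
      by_cases hx : x ∈ K₀
      · by_cases hy : y ∈ K₁
        · rw [Set.indicator_of_mem hx, Set.indicator_of_mem hy, Set.indicator_of_mem (h x hx y hy)]
          simp
        · simp [hy, hb]
      · simp [hx, ha])
  rwa [lintegral_indicator_one₀ (h₀.nullMeasurableSet_addHaar μ),
    lintegral_indicator_one₀ (h₁.nullMeasurableSet_addHaar μ),
    lintegral_indicator_one₀ (hL.nullMeasurableSet_addHaar μ)] at key

/-- The Brunn–Minkowski inequality for nonempty convex sets of finite measure. -/
lemma Convex.brunn_minkowski {K₀ K₁ L : Set E} (h₀ : Convex ℝ K₀)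
    (h₁ : Convex ℝ K₁) (hL : Convex ℝ L) (hd : 0 < Module.finrank ℝ E)
    (hn₀ : K₀.Nonempty) (hn₁ : K₁.Nonempty) (hf₀ : μ K₀ ≠ ⊤) (hf₁ : μ K₁ ≠ ⊤) (hfL : μ L ≠ ⊤)
    {a b : ℝ} (ha : 0 < a) (hb : 0 < b) (h : ∀ x ∈ K₀, ∀ y ∈ K₁, a • x + b • y ∈ L) :
    a * (μ K₀).toReal ^ (Module.finrank ℝ E : ℝ)⁻¹ + b * (μ K₁).toReal ^ (Module.finrank ℝ E : ℝ)⁻¹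
      ≤ (μ L).toReal ^ (Module.finrank ℝ E : ℝ)⁻¹ := by
  set d := Module.finrank ℝ E with hd_def
  have hd' : (d : ℝ) ≠ 0 := by positivity
  have hpow : ∀ x : ℝ, 0 ≤ x → (x ^ (d : ℝ)⁻¹) ^ d = x := fun x hx => by
    rw [← Real.rpow_natCast, ← Real.rpow_mul hx, inv_mul_cancel₀ hd', Real.rpow_one]
  set α := (μ K₀).toReal ^ (d : ℝ)⁻¹ with hα
  set β := (μ K₁).toReal ^ (d : ℝ)⁻¹ with hβ
  have hα0 : 0 ≤ α := by positivity
  have hβ0 : 0 ≤ β := by positivity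
  have hμ₀ : μ K₀ = ENNReal.ofReal (α ^ d) := by
    rw [hα, hpow _ ENNReal.toReal_nonneg, ENNReal.ofReal_toReal hf₀]
  have hμ₁ : μ K₁ = ENNReal.ofReal (β ^ d) := by
    rw [hβ, hpow _ ENNReal.toReal_nonneg, ENNReal.ofReal_toReal hf₁]
  suffices hs : ENNReal.ofReal ((a * α + b * β) ^ d) ≤ μ L by
    rw [ENNReal.ofReal_le_iff_le_toReal hfL] at hs
    calc a * α + b * β = ((a * α + b * β) ^ d) ^ (d : ℝ)⁻¹ := by
          rw [← Real.rpow_natCast, ← Real.rpow_mul (by positivity), mul_inv_cancel₀ hd',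
            Real.rpow_one]
      _ ≤ _ := Real.rpow_le_rpow (by positivity) hs (by positivity)
  rcases hα0.eq_or_lt with hα0 | hα0
  -- If `K₀` is null, `L` still contains a translate of `b • K₁`, which has the required volume.
  -- This is where nonemptiness enters.
  · obtain ⟨x, hx⟩ := hn₀
    calc ENNReal.ofReal ((a * α + b * β) ^ d) = μ ((a • x) +ᵥ (b • K₁)) := by
          rw [measure_vadd, Measure.addHaar_smul, hμ₁, ← hα0, mul_zero, zero_add, mul_pow,
            ENNReal.ofReal_mul (by positivity), abs_of_pos (by positivity)]
      _ ≤ μ L := by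
          refine measure_mono ?_
          rintro _ ⟨_, ⟨y, hy, rfl⟩, rfl⟩
          exact h x hx y hy
  rcases hβ0.eq_or_lt with hβ0 | hβ0
  · obtain ⟨y, hy⟩ := hn₁
    calc ENNReal.ofReal ((a * α + b * β) ^ d) = μ ((b • y) +ᵥ (a • K₀)) := by
          rw [measure_vadd, Measure.addHaar_smul, hμ₀, ← hβ0, mul_zero, add_zero, mul_pow,
            ENNReal.ofReal_mul (by positivity), abs_of_pos (by positivity)]
      _ ≤ μ L := by
          refine measure_mono ?_
          rintro _ ⟨_, ⟨x, hx, rfl⟩, rfl⟩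
          simpa [add_comm] using h x hx y hy
  set s := a * α + b * β with hs
  have hs0 : 0 < s := by positivity
  have hab' : a * α / s + b * β / s = 1 := by rw [← add_div, ← hs, div_self hs0.ne']
  -- Dilated by `s / α` and `s / β`, both sets have volume `s ^ d`, so the geometric mean loses
  -- nothing; the weights are chosen so that the combination is again `a • x + b • y`.
  have key := Convex.measure_rpow_mul_measure_rpow_le μ (h₀.smul (s / α)) (h₁.smul (s / β)) hL
    (a := a * α / s) (b := b * β / s) (by positivity) (by positivity) hab' (by
      rintro _ ⟨x, hx, rfl⟩ _ ⟨y, hy, rfl⟩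
      simp only [smul_smul]
      have e1 : a * α / s * (s / α) = a := by field_simp
      have e2 : b * β / s * (s / β) = b := by field_simp
      rw [e1, e2]
      exact h x hx y hy)
  have hsc : ∀ γ : ℝ, 0 < γ → ENNReal.ofReal |(s / γ) ^ d| * ENNReal.ofReal (γ ^ d)
      = ENNReal.ofReal (s ^ d) := by
    intro γ hγ
    rw [abs_of_pos (by positivity), ← ENNReal.ofReal_mul (by positivity), ← mul_pow,
      div_mul_cancel₀ _ hγ.ne']
  rw [Measure.addHaar_smul, Measure.addHaar_smul, hμ₀, hμ₁, hsc α hα0, hsc β hβ0,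
    ennreal_rpow_mul_rpow_self (by positivity) (by positivity) hab'] at key
  exact key

end BrunnMinkowski

/-! ### Borell's reverse Hölder inequality -/

section Borell

lemma ENNReal.mul_add_mul_le_mul_add_mul {a b c d : ℝ≥0∞} (hab : a ≤ b) (hcd : c ≤ d) :
    a * d + b * c ≤ a * c + b * d := by
  obtain ⟨x, rfl⟩ := exists_add_of_le hab
  obtain ⟨y, rfl⟩ := exists_add_of_le hcd
  calc a * (c + y) + (a + x) * c ≤ a * (c + y) + (a + x) * c + x * y := le_self_add
    _ = _ := by ring

lemma lintegral_exp_neg_mul_rpow {r α : ℝ} (hr : 0 < r) (hα : 0 < α) :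
    ENNReal.ofReal α * ∫⁻ t in Set.Ioi (0 : ℝ),
      ENNReal.ofReal (Real.exp (-(r⁻¹ * t))) * ENNReal.ofReal (t ^ (α - 1))
    = ENNReal.ofReal (Real.Gamma (α + 1) * r ^ α) := by
  have h1 := Real.integral_rpow_mul_exp_neg_mul_Ioi hα (inv_pos.2 hr)
  have hpos : 0 < (1 / r⁻¹) ^ α * Real.Gamma α := by
    have := Real.Gamma_pos_of_pos hα
    positivity
  -- The Bochner integral of a non-integrable function is 0, whereas the known value is positive.
  have hint : Integrable (fun t : ℝ => t ^ (α - 1) * Real.exp (-(r⁻¹ * t)))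
      (volume.restrict (Set.Ioi 0)) := by
    by_contra hc
    rw [integral_undef hc] at h1
    exact hpos.ne h1
  have h2 := ofReal_integral_eq_lintegral_ofReal hint
    ((ae_restrict_iff' measurableSet_Ioi).2 (.of_forall fun t ht => by
      have : (0 : ℝ) < t := ht
      show 0 ≤ _
      positivity))
  have h3 : ∫⁻ t in Set.Ioi (0 : ℝ),
      ENNReal.ofReal (Real.exp (-(r⁻¹ * t))) * ENNReal.ofReal (t ^ (α - 1))
      = ∫⁻ t in Set.Ioi (0 : ℝ), ENNReal.ofReal (t ^ (α - 1) * Real.exp (-(r⁻¹ * t))) := by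
    refine lintegral_congr fun t => ?_
    rw [← ENNReal.ofReal_mul (Real.exp_pos _).le, mul_comm]
  rw [h3, ← h2, h1, ← ENNReal.ofReal_mul hα.le, Real.Gamma_add_one hα.ne']
  congr 1
  rw [one_div, inv_inv]
  ring

/-- A single-crossing comparison of moments. -/
lemma lintegral_moment_le_of_single_crossing {m e : ℝ → ℝ≥0∞} {α β t₀ : ℝ} (hαβ : α ≤ β)
    (ht₀ : 0 ≤ t₀) (hm : Measurable m) (he : Measurable e)
    (h1 : ∀ t, 0 < t → t < t₀ → e t ≤ m t) (h2 : ∀ t, t₀ < t → m t ≤ e t)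
    (heq : ∫⁻ t in Set.Ioi (0 : ℝ), m t * ENNReal.ofReal (t ^ (α - 1))
      = ∫⁻ t in Set.Ioi (0 : ℝ), e t * ENNReal.ofReal (t ^ (α - 1)))
    (hfin : ∫⁻ t in Set.Ioi (0 : ℝ), m t * ENNReal.ofReal (t ^ (α - 1)) ≠ ⊤) :
    ∫⁻ t in Set.Ioi (0 : ℝ), m t * ENNReal.ofReal (t ^ (β - 1))
      ≤ ∫⁻ t in Set.Ioi (0 : ℝ), e t * ENNReal.ofReal (t ^ (β - 1)) := by
  have hpow : ∀ γ : ℝ, Measurable fun t : ℝ => ENNReal.ofReal (t ^ γ) := fun γ => by fun_prop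
  -- The pointwise inequality is `(t ^ (β - α) - t₀ ^ (β - α)) * (m t - e t) ≤ 0`, with its terms
  -- moved so that nothing is subtracted in `[0, ∞]`. After integration the two terms with factor
  -- `v` agree and are finite, so they cancel.
  set v := ENNReal.ofReal (t₀ ^ (β - α)) with hv
  have hpt : ∀ t ∈ Set.Ioi (0 : ℝ),
      m t * ENNReal.ofReal (t ^ (β - 1)) + v * (e t * ENNReal.ofReal (t ^ (α - 1)))
      ≤ e t * ENNReal.ofReal (t ^ (β - 1)) + v * (m t * ENNReal.ofReal (t ^ (α - 1))) := by
    intro t ht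
    have ht : 0 < t := ht
    have hs : ENNReal.ofReal (t ^ (β - 1))
        = ENNReal.ofReal (t ^ (β - α)) * ENNReal.ofReal (t ^ (α - 1)) := by
      rw [← ENNReal.ofReal_mul (by positivity), ← Real.rpow_add ht]
      congr 2; ring
    rw [hs]
    set u := ENNReal.ofReal (t ^ (α - 1))
    set w := ENNReal.ofReal (t ^ (β - α)) with hw
    have : m t * w + v * e t ≤ e t * w + v * m t := by
      rcases lt_trichotomy t t₀ with h | h | h
      · have hwv : w ≤ v :=
          ENNReal.ofReal_le_ofReal (Real.rpow_le_rpow ht.le h.le (by linarith))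
        calc m t * w + v * e t = w * m t + v * e t := by ring
          _ ≤ w * e t + v * m t := ENNReal.mul_add_mul_le_mul_add_mul hwv (h1 t ht h)
          _ = _ := by ring
      · have : w = v := by rw [hw, hv, h]
        rw [this]
        exact le_of_eq (by ring)
      · have hwv : v ≤ w :=
          ENNReal.ofReal_le_ofReal (Real.rpow_le_rpow ht₀ h.le (by linarith))
        calc m t * w + v * e t = v * e t + w * m t := by ring
          _ ≤ v * m t + w * e t := ENNReal.mul_add_mul_le_mul_add_mul hwv (h2 t h)
          _ = _ := by ring
    calc _ = (m t * w + v * e t) * u := by ring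
      _ ≤ (e t * w + v * m t) * u := by gcongr
      _ = _ := by ring
  have hint := setLIntegral_mono (μ := (volume : Measure ℝ)) (by fun_prop) hpt
  rw [lintegral_add_left (by fun_prop), lintegral_add_left (by fun_prop),
    lintegral_const_mul _ (by fun_prop), lintegral_const_mul _ (by fun_prop), ← heq] at hint
  exact (ENNReal.add_le_add_iff_right (ENNReal.mul_ne_top ENNReal.ofReal_ne_top hfin)).1 hint

variable {E : Type*} [NormedAddCommGroup E] [NormedSpace ℝ E] [FiniteDimensional ℝ E]
  [MeasurableSpace E] [BorelSpace E] (μ : Measure E) [μ.IsAddHaarMeasure]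

/-- For `t > 0` the superlevel set avoids the zeros of `ρ`, so only the concavity on the support of
`ρ` is needed. -/
lemma convex_superlevel_of_concave_on_support {E : Type*} [AddCommGroup E] [Module ℝ E]
    {ρ : E → ℝ≥0∞} {ψ : E → ℝ} (hψ_zero : ∀ x, ρ x = 0 → ψ x = 0)
    (hψ : ∀ x y, ρ x ≠ 0 → ρ y ≠ 0 → ∀ a b : ℝ, 0 < a → 0 < b → a + b = 1 →
      a * ψ x + b * ψ y ≤ ψ (a • x + b • y)) {t : ℝ} (ht : 0 < t) :
    Convex ℝ {x | t ≤ ψ x} := by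
  rw [convex_iff_forall_pos]
  intro x hx y hy a b ha hb hab
  have hx' : ρ x ≠ 0 := fun h => by
    have h1 : t ≤ ψ x := hx
    rw [hψ_zero x h] at h1; linarith
  have hy' : ρ y ≠ 0 := fun h => by
    have h1 : t ≤ ψ y := hy
    rw [hψ_zero y h] at h1; linarith
  refine le_trans ?_ (hψ x y hx' hy' a b ha hb hab)
  calc t = a * t + b * t := by rw [← add_mul, hab, one_mul]
    _ ≤ _ := add_le_add (mul_le_mul_of_nonneg_left hx ha.le) (mul_le_mul_of_nonneg_left hy hb.le)

lemma aemeasurable_of_concave_on_support {ρ : E → ℝ≥0∞} {ψ : E → ℝ} (hψ_nonneg : ∀ x, 0 ≤ ψ x)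
    (hψ_zero : ∀ x, ρ x = 0 → ψ x = 0)
    (hψ : ∀ x y, ρ x ≠ 0 → ρ y ≠ 0 → ∀ a b : ℝ, 0 < a → 0 < b → a + b = 1 →
      a * ψ x + b * ψ y ≤ ψ (a • x + b • y)) :
    AEMeasurable ψ μ := by
  have h1 : AEMeasurable (fun x => ENNReal.ofReal (ψ x)) μ := by
    refine aemeasurable_of_convex_superlevel μ fun t => ?_
    rw [convex_iff_forall_pos]
    intro x hx y hy a b ha hb hab
    have hmin : 0 < min (ψ x) (ψ y) := by
      refine lt_min ?_ ?_
      · exact ENNReal.ofReal_pos.1 (lt_of_le_of_lt zero_le hx)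
      · exact ENNReal.ofReal_pos.1 (lt_of_le_of_lt zero_le hy)
    have h2 : min (ψ x) (ψ y) ≤ ψ (a • x + b • y) :=
      (convex_superlevel_of_concave_on_support hψ_zero hψ hmin) (show x ∈ {z | min (ψ x) (ψ y) ≤ ψ z} from min_le_left (ψ x) (ψ y))
        (show y ∈ {z | min (ψ x) (ψ y) ≤ ψ z} from min_le_right (ψ x) (ψ y)) ha.le hb.le hab
    refine lt_of_lt_of_le ?_ (ENNReal.ofReal_le_ofReal h2)
    rw [ENNReal.ofReal_min]
    exact lt_min hx hy
  have h2 := h1.ennreal_toReal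
  simp_rw [ENNReal.toReal_ofReal (hψ_nonneg _)] at h2
  exact h2

/-- Borell's reverse Hölder inequality: moments of a bounded concave function with respect to
a log-concave weight. -/
lemma ENNLogConcave.borell {ρ : E → ℝ≥0∞} (hρ : ENNLogConcave ρ) (hL : ∫⁻ x, ρ x ∂μ ≠ ⊤)
    {ψ : E → ℝ} (hψ_nonneg : ∀ x, 0 ≤ ψ x) {R : ℝ} (hψ_le : ∀ x, ψ x ≤ R)
    (hψ_zero : ∀ x, ρ x = 0 → ψ x = 0)
    (hψ : ∀ x y, ρ x ≠ 0 → ρ y ≠ 0 → ∀ a b : ℝ, 0 < a → 0 < b → a + b = 1 →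
      a * ψ x + b * ψ y ≤ ψ (a • x + b • y))
    {α β : ℝ} (hα : 0 < α) (hαβ : α ≤ β) :
    ∫⁻ x, ENNReal.ofReal (ψ x ^ β) ∂(μ.withDensity ρ) ≤
      ENNReal.ofReal (Real.Gamma (β + 1)) * (∫⁻ x, ρ x ∂μ) *
        ((∫⁻ x, ENNReal.ofReal (ψ x ^ α) ∂(μ.withDensity ρ)) /
          (ENNReal.ofReal (Real.Gamma (α + 1)) * ∫⁻ x, ρ x ∂μ)) ^ (β / α) := by
  have hβ : 0 < β := hα.trans_le hαβ
  set L := ∫⁻ x, ρ x ∂μ with hLdef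
  set ν := μ.withDensity ρ with hν
  have hνuniv : ν Set.univ = L := by rw [hν, withDensity_apply _ .univ, Measure.restrict_univ]
  have hpos : ∀ x y, ρ x ≠ 0 → ρ y ≠ 0 → ∀ a b : ℝ, 0 < a → 0 < b → a + b = 1 →
      ρ (a • x + b • y) ≠ 0 := by
    intro x y hx hy a b ha hb hab h0
    have := hρ x y a b ha hb hab
    rw [h0, nonpos_iff_eq_zero, mul_eq_zero, ENNReal.rpow_eq_zero_iff,
      ENNReal.rpow_eq_zero_iff] at this
    rcases this with (⟨h, -⟩ | ⟨-, h⟩) | (⟨h, -⟩ | ⟨-, h⟩)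
    exacts [hx h, absurd h ha.not_gt, hy h, absurd h hb.not_gt]
  have hconv : ∀ t : ℝ, 0 < t → Convex ℝ {x | t ≤ ψ x} := fun t ht =>
    convex_superlevel_of_concave_on_support hψ_zero hψ ht
  have hψm : AEMeasurable ψ ν :=
    (aemeasurable_of_concave_on_support μ hψ_nonneg hψ_zero hψ).mono_ac
      (withDensity_absolutelyContinuous _ _)
  set m : ℝ → ℝ≥0∞ := fun t => ν {x | t ≤ ψ x} with hm
  have hm_anti : Antitone m := fun s t hst => measure_mono fun x hx => le_trans hst hx
  have hm_fin : ∀ t, m t ≠ ⊤ := fun t =>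
    ne_top_of_le_ne_top (hνuniv ▸ hL) (measure_mono (Set.subset_univ _))
  have hm_eq : ∀ t, 0 < t → m t = ∫⁻ x, {x | t ≤ ψ x}.indicator ρ x ∂μ := by
    intro t ht
    rw [hm, lintegral_indicator₀ ((hconv t ht).nullMeasurableSet_addHaar μ)]
    exact withDensity_apply₀ _ ((hconv t ht).nullMeasurableSet_addHaar μ)
  -- Equivalently, `(m t / L) ^ (1 / t)` is nonincreasing. This is Prékopa–Leindler for `ρ` and its
  -- restrictions to `{t ≤ ψ}` and `{s ≤ ψ}`: if `ψ y ≥ t`, then concavity and `ψ x ≥ 0` give value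
  -- at least `s` at the combined point.
  have hm_lc : ∀ s t : ℝ, 0 < s → s < t → L ^ (1 - s / t) * m t ^ (s / t) ≤ m s := by
    intro s t hs hst
    have ht : 0 < t := hs.trans hst
    rw [hm_eq s hs, hm_eq t ht]
    have h1 : 0 < 1 - s / t := by rw [sub_pos, div_lt_one ht]; exact hst
    have h2 : 0 < s / t := by positivity
    refine prekopaLeindler_addHaar μ _ _ _ hρ (hρ.indicator (hconv t ht))
      (hρ.indicator (hconv s hs)) _ _ h1 h2 (by ring) fun x y => ?_
    by_cases hx : ρ x = 0
    · rw [hx, ENNReal.zero_rpow_of_pos h1, zero_mul]; exact zero_le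
    by_cases hy : t ≤ ψ y
    · have hy' : ρ y ≠ 0 := fun h => by rw [hψ_zero y h] at hy; linarith
      rw [Set.indicator_of_mem (by exact hy), Set.indicator_of_mem]
      · exact hρ x y _ _ h1 h2 (by ring)
      · show s ≤ _
        refine le_trans ?_ (hψ x y hx hy' _ _ h1 h2 (by ring))
        calc s = s / t * t := by field_simp
          _ ≤ s / t * ψ y := by gcongr
          _ ≤ _ := le_add_of_nonneg_left (mul_nonneg h1.le (hψ_nonneg x))
    · rw [Set.indicator_of_notMem (by exact hy), ENNReal.zero_rpow_of_pos h2, mul_zero]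
      exact zero_le
  have hlayer : ∀ γ : ℝ, 0 < γ → ∫⁻ x, ENNReal.ofReal (ψ x ^ γ) ∂ν = ENNReal.ofReal γ *
      ∫⁻ t in Set.Ioi (0 : ℝ), m t * ENNReal.ofReal (t ^ (γ - 1)) := fun γ hγ =>
    lintegral_rpow_eq_lintegral_meas_le_mul ν (.of_forall hψ_nonneg) hψm hγ
  have hGα : 0 < Real.Gamma (α + 1) := Real.Gamma_pos_of_pos (by linarith)
  set I := ∫⁻ x, ENNReal.ofReal (ψ x ^ α) ∂ν with hI
  by_cases hI0 : I = 0
  · have h1 : ∀ᵐ x ∂ν, ψ x = 0 := by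
      rw [hI, lintegral_eq_zero_iff' (by fun_prop)] at hI0
      filter_upwards [hI0] with x hx
      have : ψ x ^ α ≤ 0 := ENNReal.ofReal_eq_zero.1 hx
      have h0 := le_antisymm this (Real.rpow_nonneg (hψ_nonneg x) _)
      exact (Real.rpow_eq_zero (hψ_nonneg x) hα.ne').1 h0
    have h2 : ∫⁻ x, ENNReal.ofReal (ψ x ^ β) ∂ν = 0 := by
      rw [lintegral_eq_zero_iff' (by fun_prop)]
      filter_upwards [h1] with x hx
      simp [hx, Real.zero_rpow hβ.ne']
    rw [h2]; exact zero_le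
  have hR : 0 ≤ R := (hψ_nonneg 0).trans (hψ_le 0)
  have hIfin : I ≠ ⊤ := by
    refine ne_top_of_le_ne_top ?_ (lintegral_mono (g := fun _ => ENNReal.ofReal (R ^ α))
      fun x => ENNReal.ofReal_le_ofReal (Real.rpow_le_rpow (hψ_nonneg x) (hψ_le x) hα.le))
    rw [lintegral_const, hνuniv]
    exact ENNReal.mul_ne_top ENNReal.ofReal_ne_top hL
  have hL0 : L ≠ 0 := by
    intro h
    apply hI0
    have : ν = 0 := by rw [← Measure.measure_univ_eq_zero, hνuniv, h]
    rw [hI, this, lintegral_zero_measure]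
  have hG0 : ENNReal.ofReal (Real.Gamma (α + 1)) * L ≠ 0 :=
    mul_ne_zero (by simpa using hGα) hL0
  have hG1 : ENNReal.ofReal (Real.Gamma (α + 1)) * L ≠ ⊤ :=
    ENNReal.mul_ne_top ENNReal.ofReal_ne_top hL
  -- `r` solves `Γ(α + 1) * L * r ^ α = I`, so that the exponential tail `e t = L * exp (-t / r)`
  -- has the same `α`-moment as `m`.
  set X := I / (ENNReal.ofReal (Real.Gamma (α + 1)) * L) with hX
  have hX0 : X ≠ 0 := ENNReal.div_ne_zero.2 ⟨hI0, hG1⟩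
  have hXt : X ≠ ⊤ := ENNReal.div_ne_top hIfin hG0
  have hXr : 0 < X.toReal := ENNReal.toReal_pos hX0 hXt
  set r := X.toReal ^ α⁻¹ with hr
  have hr0 : 0 < r := by positivity
  have hrα : ENNReal.ofReal (r ^ α) = X := by
    rw [hr, ← Real.rpow_mul hXr.le, inv_mul_cancel₀ hα.ne', Real.rpow_one, ENNReal.ofReal_toReal hXt]
  have hrβ : ENNReal.ofReal (r ^ β) = X ^ (β / α) := by
    rw [hr, ← Real.rpow_mul hXr.le, ← ENNReal.ofReal_rpow_of_pos hXr, ENNReal.ofReal_toReal hXt]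
    congr 1; field_simp
  set e : ℝ → ℝ≥0∞ := fun t => L * ENNReal.ofReal (Real.exp (-(r⁻¹ * t))) with he
  have hemeas : Measurable e := by fun_prop
  have heint : ∀ γ : ℝ, 0 < γ → ENNReal.ofReal γ *
      ∫⁻ t in Set.Ioi (0 : ℝ), e t * ENNReal.ofReal (t ^ (γ - 1))
      = ENNReal.ofReal (Real.Gamma (γ + 1)) * L * ENNReal.ofReal (r ^ γ) := by
    intro γ hγ
    have h1 := lintegral_exp_neg_mul_rpow hr0 hγ
    rw [ENNReal.ofReal_mul (Real.Gamma_pos_of_pos (by linarith)).le] at h1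
    rw [mul_right_comm, ← h1]
    simp_rw [he, mul_assoc]
    rw [lintegral_const_mul _ (by fun_prop)]
    ring
  -- For `e` the quantity `(e t / L) ^ (1 / t)` is constant, while for `m` it is nonincreasing: once
  -- `m` falls below `e` it stays there.
  have hcross : ∀ s t, 0 < s → s < t → m s < e s → m t ≤ e t := by
    intro s t hs hst hlt
    have ht : 0 < t := hs.trans hst
    have h1 : 0 < 1 - s / t := by rw [sub_pos, div_lt_one ht]; exact hst
    have h2 : 0 < s / t := by positivity
    have h3 := (hm_lc s t hs hst).trans hlt.le
    have h4 : e s = L ^ (1 - s / t) * (e t) ^ (s / t) := by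
      simp only [he]
      rw [ENNReal.mul_rpow_of_nonneg _ _ h2.le, ← mul_assoc,
        ennreal_rpow_mul_rpow_self h1.le h2.le (by ring),
        ENNReal.ofReal_rpow_of_pos (Real.exp_pos _), ← Real.exp_mul]
      congr 3
      field_simp
    rw [h4, ENNReal.mul_le_mul_iff_right (by simp [ENNReal.rpow_eq_zero_iff, hL0, hL])
      (ENNReal.rpow_ne_top_of_nonneg h1.le hL), ENNReal.rpow_le_rpow_iff h2] at h3
    exact h3
  set S := {t : ℝ | 0 < t ∧ m t < e t} with hS
  have hSne : S.Nonempty := by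
    -- Beyond the bound `R` of `ψ` the tail `m` vanishes, so a crossing does occur.
    refine ⟨R + 1, by positivity, ?_⟩
    have : m (R + 1) = 0 := by
      convert measure_empty (μ := ν)
      ext x
      simp only [Set.mem_ofPred_eq, Set.mem_empty_iff_false, iff_false, not_le]
      linarith [hψ_le x]
    rw [this]
    exact pos_iff_ne_zero.2 (mul_ne_zero hL0 (by simpa using Real.exp_pos _))
  have hSbdd : BddBelow S := ⟨0, fun t ht => ht.1.le⟩
  have hmom := lintegral_moment_le_of_single_crossing (t₀ := sInf S) hαβ
    (le_csInf hSne fun t ht => ht.1.le) hm_anti.measurable hemeas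
    (fun t ht0 ht => not_lt.1 fun h => notMem_of_lt_csInf ht hSbdd ⟨ht0, h⟩)
    (fun t ht => by
      obtain ⟨s, hs, hst⟩ := exists_lt_of_csInf_lt hSne ht
      exact hcross s t hs.1 hst hs.2)
    (by
      have h1 := hlayer α hα
      have h2 := heint α hα
      rw [hrα, hX, ENNReal.mul_div_cancel hG0 hG1, hI, h1] at h2
      exact ((ENNReal.mul_right_inj (by simpa using hα) ENNReal.ofReal_ne_top).1 h2).symm)
    (by
      have h1 := hlayer α hα
      intro h
      rw [h, ENNReal.mul_top (by simpa using hα)] at h1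
      exact hIfin h1)
  rw [hlayer β hβ, ← hrβ, ← heint β hβ]
  gcongr

end Borell

/-! ### The inequalities of Finner and Bollobás–Thomason -/

section Finner

variable {ι κ : Type*} [DecidableEq ι] [Fintype κ]

/-- Finner's inequality, for marginals over a finite set of variables. -/
lemma lmarginal_prod_rpow_le {T : κ → Finset ι} {q : κ → ℝ} (hq : ∀ j, 0 ≤ q j)
    {g : κ → (ι → ℝ) → ℝ≥0∞} (hg : ∀ j, Measurable (g j))
    (hdep : ∀ j, ∀ i ∉ T j, ∀ x y, g j (Function.update x i y) = g j x) (A : Finset ι)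
    (hcover : ∀ i ∈ A, ∑ j, q j * (if i ∈ T j then 1 else 0) = 1) (x : ι → ℝ) :
    lmarginal (fun _ => volume) A (fun x => ∏ j, g j x ^ q j) x ≤
      ∏ j, lmarginal (fun _ => volume) (A ∩ T j) (g j) x ^ q j := by
  have hm : ∀ j s, Measurable (lmarginal (fun _ => volume) s (g j)) := fun j s => (hg j).lmarginal _
  induction A using Finset.induction generalizing x with
  | empty => simp
  | insert i A hi ih =>
    have ih := ih fun i hi => hcover i (Finset.mem_insert_of_mem hi)
    let G : κ → (ι → ℝ) → ℝ≥0∞ := fun j => lmarginal (fun _ => volume) (A ∩ T j) (g j)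
    have hmem : ∀ j, i ∈ T j → lmarginal (fun _ => volume) (insert i A ∩ T j) (g j) x
        = ∫⁻ y, G j (Function.update x i y) := by
      intro j hj
      rw [Finset.insert_inter_of_mem hj, lmarginal_insert _ (hg j) (by simp [hi])]
    have hnot : ∀ j, i ∉ T j → lmarginal (fun _ => volume) (insert i A ∩ T j) (g j) x = G j x := by
      intro j hj
      rw [Finset.insert_inter_of_notMem hj]
    have hconst : ∀ j, i ∉ T j → ∀ y, G j (Function.update x i y) = G j x := by
      intro j hj y
      simp only [G]
      rw [lmarginal_update_of_notMem (hg j) (by simp [hj])]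
      congr 1
      funext z
      exact hdep j i hj z y
    have hmG : ∀ j, Measurable fun y => G j (Function.update x i y) := fun j =>
      (hm j _).comp (measurable_update x)
    rw [lmarginal_insert _ (Finset.measurable_prod _ fun j _ => (hg j).pow_const _) hi]
    refine (lintegral_mono (g := fun y => ∏ j, G j (Function.update x i y) ^ q j)
      fun y => ih (Function.update x i y)).trans ?_
    -- The factors with `i ∉ T j` do not depend on the variable `i` and leave the integral. For the
    -- others the weights `q j` sum to 1 by the cover condition at `i`, so Hölder applies.
    simp_rw [← Finset.prod_filter_mul_prod_filter_not Finset.univ (fun j => i ∈ T j)]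
    have e1 : ∀ y, ∏ j ∈ Finset.univ.filter (fun j => i ∉ T j), G j (Function.update x i y) ^ q j
        = ∏ j ∈ Finset.univ.filter (fun j => i ∉ T j), G j x ^ q j := fun y =>
      Finset.prod_congr rfl fun j hj => by rw [hconst j (Finset.mem_filter.1 hj).2]
    have e2 : ∏ j ∈ Finset.univ.filter (fun j => i ∉ T j),
        lmarginal (fun _ => volume) (insert i A ∩ T j) (g j) x ^ q j
        = ∏ j ∈ Finset.univ.filter (fun j => i ∉ T j), G j x ^ q j :=
      Finset.prod_congr rfl fun j hj => by rw [hnot j (Finset.mem_filter.1 hj).2]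
    have e3 : ∏ j ∈ Finset.univ.filter (fun j => i ∈ T j),
        lmarginal (fun _ => volume) (insert i A ∩ T j) (g j) x ^ q j
        = ∏ j ∈ Finset.univ.filter (fun j => i ∈ T j),
          (∫⁻ y, G j (Function.update x i y)) ^ q j :=
      Finset.prod_congr rfl fun j hj => by rw [hmem j (Finset.mem_filter.1 hj).2]
    rw [e2, e3]
    simp_rw [e1]
    rw [lintegral_mul_const _ (Finset.measurable_prod _ fun j _ => (hmG j).pow_const _)]
    gcongr
    refine ENNReal.lintegral_prod_norm_pow_le _ (fun j _ => (hmG j).aemeasurable) ?_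
      fun j _ => hq j
    have := hcover i (Finset.mem_insert_self _ _)
    simpa [Finset.sum_filter] using this

/-- The Bollobás–Thomason inequality for a weighted uniform cover. -/
lemma volume_le_prod_volume_image_restrict_rpow [Fintype ι] {T : κ → Finset ι} {q : κ → ℝ}
    (hq : ∀ j, 0 ≤ q j) (hcover : ∀ i, ∑ j, q j * (if i ∈ T j then 1 else 0) = 1)
    (K : Set (ι → ℝ)) :
    volume K ≤ ∏ j, volume ((T j).restrict '' K) ^ q j := by
  -- Neither `K` nor its projections need be measurable; Finner's inequality is applied to
  -- indicators of measurable hulls of the projections.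
  set M : ∀ j, Set (T j → ℝ) := fun j => toMeasurable volume ((T j).restrict '' K) with hM
  have hMm : ∀ j, MeasurableSet (M j) := fun j => measurableSet_toMeasurable _ _
  set g : κ → (ι → ℝ) → ℝ≥0∞ := fun j x => (M j).indicator 1 ((T j).restrict x) with hg
  have hgm : ∀ j, Measurable (g j) := fun j =>
    (measurable_one.indicator (hMm j)).comp (Finset.measurable_restrict _)
  have hfin := lmarginal_prod_rpow_le hq hgm (fun j i hi x y => by
    simp only [hg]
    congr 1
    funext k
    simp only [Finset.restrict]
    rw [Function.update_of_ne]
    rintro rfl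
    exact hi k.2) Finset.univ (fun i _ => hcover i) 0
  rw [lmarginal_univ] at hfin
  have hR : ∀ j, lmarginal (fun _ => volume) (Finset.univ ∩ T j) (g j) (0 : ι → ℝ)
      = volume ((T j).restrict '' K) := by
    intro j
    rw [Finset.univ_inter, lmarginal]
    simp only [hg, Function.restrict_updateFinset]
    exact (lintegral_indicator_one (hMm j)).trans (measure_toMeasurable _)
  simp_rw [hR] at hfin
  refine le_trans ?_ hfin
  have hKm : MeasurableSet (⋂ j, (T j).restrict (π := fun _ => ℝ) ⁻¹' M j) :=
    MeasurableSet.iInter fun j => (Finset.measurable_restrict _) (hMm j)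
  calc volume K ≤ volume (⋂ j, (T j).restrict (π := fun _ => ℝ) ⁻¹' M j) := by
        refine measure_mono fun x hx => Set.mem_iInter.2 fun j => ?_
        exact subset_toMeasurable _ _ ⟨x, hx, rfl⟩
    _ = ∫⁻ x, (⋂ j, (T j).restrict (π := fun _ => ℝ) ⁻¹' M j).indicator 1 x :=
        (lintegral_indicator_one hKm).symm
    _ ≤ _ := by
        refine lintegral_mono fun x => ?_
        by_cases hx : x ∈ ⋂ j, (T j).restrict (π := fun _ => ℝ) ⁻¹' M j
        swap
        · rw [Set.indicator_of_notMem hx]; exact zero_le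
        have : ∀ j, g j x = 1 := fun j =>
          Set.indicator_of_mem (show (T j).restrict x ∈ M j from Set.mem_iInter.1 hx j) _
        simp [this, hx]

end Finner

/-! ### Slicing log-concave functions at heights e⁻ʳ -/

section LevelSets

lemma lintegral_indicator_ofReal_exp_neg_lt {a : ℝ≥0∞} (ha : a ≠ ⊤) :
    ∫⁻ r : ℝ, {r : ℝ | ENNReal.ofReal (Real.exp (-r)) < a}.indicator
      (fun r => ENNReal.ofReal (Real.exp (-r))) r = a := by
  lift a to NNReal using ha
  rcases eq_or_ne a 0 with rfl | h0
  · simp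
  have hpos : (0 : ℝ) < a := by positivity
  have hset : {r : ℝ | ENNReal.ofReal (Real.exp (-r)) < a} = Set.Ioi (-Real.log a) := by
    ext r
    rw [Set.mem_ofPred_eq, Set.mem_Ioi, ← ENNReal.ofReal_coe_nnreal,
      ENNReal.ofReal_lt_ofReal_iff hpos, ← Real.lt_log_iff_exp_lt hpos, neg_lt]
  rw [hset, lintegral_indicator measurableSet_Ioi, ← ofReal_integral_eq_lintegral_ofReal
    (integrableOn_exp_neg_Ioi _) (.of_forall fun r => (Real.exp_pos _).le), integral_exp_neg_Ioi,
    neg_neg, Real.exp_log hpos, ENNReal.ofReal_coe_nnreal]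

lemma ofReal_exp_neg_convexCombination {r s a b : ℝ} :
    ENNReal.ofReal (Real.exp (-(a * r + b * s))) =
      ENNReal.ofReal (Real.exp (-r)) ^ a * ENNReal.ofReal (Real.exp (-s)) ^ b := by
  rw [ENNReal.ofReal_rpow_of_pos (Real.exp_pos _), ENNReal.ofReal_rpow_of_pos (Real.exp_pos _),
    ← ENNReal.ofReal_mul (by positivity), ← Real.exp_mul, ← Real.exp_mul, ← Real.exp_add]
  congr 2; ring

lemma ENNLogConcave.exp_neg_lt {E : Type*} [AddCommGroup E] [Module ℝ E] {g : E → ℝ≥0∞}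
    (hg : ENNLogConcave g) {x y : E} {r s a b : ℝ} (ha : 0 < a) (hb : 0 < b) (hab : a + b = 1)
    (hx : ENNReal.ofReal (Real.exp (-r)) < g x) (hy : ENNReal.ofReal (Real.exp (-s)) < g y) :
    ENNReal.ofReal (Real.exp (-(a * r + b * s))) < g (a • x + b • y) := by
  rw [ofReal_exp_neg_convexCombination]
  exact lt_of_lt_of_le
    (ENNReal.mul_lt_mul (ENNReal.rpow_lt_rpow hx ha) (ENNReal.rpow_lt_rpow hy hb))
    (hg x y a b ha hb hab)

/-- The weight `e⁻ʳ` on the region `e⁻ʳ < g x`. -/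
noncomputable def expWeight {E : Type*} (g : E → ℝ≥0∞) : E × ℝ → ℝ≥0∞ :=
  {p | ENNReal.ofReal (Real.exp (-p.2)) < g p.1}.indicator
    fun p => ENNReal.ofReal (Real.exp (-p.2))

lemma expWeight_ne_zero_iff {E : Type*} {g : E → ℝ≥0∞} {p : E × ℝ} :
    expWeight g p ≠ 0 ↔ ENNReal.ofReal (Real.exp (-p.2)) < g p.1 := by
  rw [expWeight, ne_eq, Set.indicator_apply_eq_zero]
  simp [Real.exp_pos]

lemma expWeight_ne_top {E : Type*} (g : E → ℝ≥0∞) (p : E × ℝ) : expWeight g p ≠ ⊤ := by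
  by_cases hp : p ∈ {p : E × ℝ | ENNReal.ofReal (Real.exp (-p.2)) < g p.1}
  · rw [expWeight, Set.indicator_of_mem hp]; exact ENNReal.ofReal_ne_top
  · rw [expWeight, Set.indicator_of_notMem hp]; exact ENNReal.zero_ne_top

/-- The reason for writing heights as `e⁻ʳ`: the region `e⁻ʳ < g x` is then convex in `(x, r)`, and
the weight `e⁻ʳ` is log-affine. -/
lemma ENNLogConcave.to_expWeight {E : Type*} [AddCommGroup E] [Module ℝ E] {g : E → ℝ≥0∞}
    (hg : ENNLogConcave g) : ENNLogConcave (expWeight g) := by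
  refine ENNLogConcave.indicator ?_ ?_
  · rintro ⟨x, r⟩ ⟨y, s⟩ a b ha hb hab
    exact ofReal_exp_neg_convexCombination.ge
  · rw [convex_iff_forall_pos]
    rintro ⟨x, r⟩ hx ⟨y, s⟩ hy a b ha hb hab
    exact hg.exp_neg_lt ha hb hab hx hy

variable {E Z : Type*} [NormedAddCommGroup E] [NormedSpace ℝ E] [FiniteDimensional ℝ E]
  [MeasurableSpace E] [BorelSpace E] [NormedAddCommGroup Z] [NormedSpace ℝ Z]
  [FiniteDimensional ℝ Z] [MeasurableSpace Z] [BorelSpace Z] (ν : Measure E) [ν.IsAddHaarMeasure]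
  (μ : Measure Z) [μ.IsAddHaarMeasure]

lemma ENNLogConcave.lintegral_expWeight {g : Z → ℝ≥0∞} (hg : ENNLogConcave g)
    (hfin : ∀ z, g z ≠ ⊤) :
    ∫⁻ p, expWeight g p ∂(μ.prod volume) = ∫⁻ z, g z ∂μ := by
  rw [lintegral_prod _ (hg.to_expWeight.aemeasurable _)]
  exact lintegral_congr fun z => lintegral_indicator_ofReal_exp_neg_lt (hfin z)

/-- The integral of `e⁻ʳ` over `e⁻ʳ < g` is `g`; Tonelli then integrates the variable `u` first. -/
lemma ENNLogConcave.lintegral_eq_lintegral_level {g : E × Z → ℝ≥0∞} (hg : ENNLogConcave g)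
    (hfin : ∀ z, g z ≠ ⊤) :
    ∫⁻ p, g p ∂(ν.prod μ) = ∫⁻ p : Z × ℝ, ENNReal.ofReal (Real.exp (-p.2)) *
      ν {u | ENNReal.ofReal (Real.exp (-p.2)) < g (u, p.1)} ∂(μ.prod volume) := by
  rw [← hg.lintegral_expWeight (ν.prod μ) hfin]
  have hlc : ENNLogConcave fun q : E × Z × ℝ => expWeight g ((q.1, q.2.1), q.2.2) :=
    hg.to_expWeight.comp_linearMap
      (LinearMap.prod (LinearMap.prod (LinearMap.fst ℝ E (Z × ℝ))
        (LinearMap.fst ℝ Z ℝ ∘ₗ LinearMap.snd ℝ E (Z × ℝ)))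
        (LinearMap.snd ℝ Z ℝ ∘ₗ LinearMap.snd ℝ E (Z × ℝ)))
  have h1 := (measurePreserving_prodAssoc ν μ (volume : Measure ℝ)).lintegral_comp_emb
    MeasurableEquiv.prodAssoc.measurableEmbedding
    fun q : E × Z × ℝ => expWeight g ((q.1, q.2.1), q.2.2)
  refine h1.trans ?_
  have : (μ.prod (volume : Measure ℝ)).IsAddHaarMeasure := inferInstance
  rw [lintegral_prod_symm _ (hlc.aemeasurable (ν.prod (μ.prod volume)))]
  refine lintegral_congr fun p => ?_
  have hconv : Convex ℝ {u | ENNReal.ofReal (Real.exp (-p.2)) < g (u, p.1)} := by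
    rw [convex_iff_forall_pos]
    intro u hu v hv a b ha hb hab
    have := hg.exp_neg_lt ha hb hab hu hv
    rwa [Prod.smul_mk, Prod.smul_mk, Prod.mk_add_mk, ← add_smul, ← add_mul, hab, one_smul,
      one_mul] at this
  rw [← lintegral_indicator_const₀ (hconv.nullMeasurableSet_addHaar ν)]
  rfl

end LevelSets

/-! ### Volumes of projected slices -/

section CoordinateProjections

variable {ι Z : Type*} [Fintype ι] [DecidableEq ι]

/-- The projection `ℝ^ι × Z → ℝ^A × Z`. -/
def coordProj (Z : Type*) [AddCommGroup Z] [Module ℝ Z] (A : Finset ι) :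
    ((ι → ℝ) × Z) →ₗ[ℝ] ((A → ℝ) × Z) :=
  LinearMap.prodMap (LinearMap.funLeft ℝ ℝ (Subtype.val : A → ι)) LinearMap.id

variable [NormedAddCommGroup Z] [NormedSpace ℝ Z]

/-- The volume of the fibre over `z` of the superlevel set at height `e⁻ʳ` of the projection
of `f` to `ℝ^A × Z`. -/
noncomputable def levelVol (f : (ι → ℝ) × Z → ℝ≥0∞) (A : Finset ι) (p : Z × ℝ) : ℝ≥0∞ :=
  volume {u : A → ℝ | ENNReal.ofReal (Real.exp (-p.2)) < supFiber (coordProj Z A) f (u, p.1)}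

/-- The supremum of `f (x, z)` over `x`. -/
noncomputable def fibreSup (f : (ι → ℝ) × Z → ℝ≥0∞) : Z → ℝ≥0∞ :=
  supFiber (LinearMap.snd ℝ (ι → ℝ) Z) f

lemma lt_fibreSup_iff {f : (ι → ℝ) × Z → ℝ≥0∞} {z : Z} {t : ℝ≥0∞} :
    t < fibreSup f z ↔ ∃ x, t < f (x, z) := by
  rw [fibreSup, lt_supFiber_iff]
  constructor
  · rintro ⟨⟨x, z'⟩, rfl, h⟩
    exact ⟨x, h⟩
  · rintro ⟨x, h⟩
    exact ⟨(x, z), rfl, h⟩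

lemma lt_supFiber_coordProj_iff {f : (ι → ℝ) × Z → ℝ≥0∞} {A : Finset ι} {u : A → ℝ} {z : Z}
    {t : ℝ≥0∞} :
    t < supFiber (coordProj Z A) f (u, z) ↔ ∃ x, A.restrict x = u ∧ t < f (x, z) := by
  rw [lt_supFiber_iff]
  constructor
  · rintro ⟨⟨x, z'⟩, hx, h⟩
    obtain ⟨h1, h2⟩ := Prod.ext_iff.1 hx
    have h2 : z' = z := h2
    subst h2
    exact ⟨x, h1, h⟩
  · rintro ⟨x, hx, h⟩
    exact ⟨(x, z), Prod.ext hx rfl, h⟩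

lemma ENNLogConcave.to_fibreSup {f : (ι → ℝ) × Z → ℝ≥0∞} (hf : ENNLogConcave f) :
    ENNLogConcave (fibreSup f) :=
  hf.supFiber _

lemma levelSet_nonempty_iff {f : (ι → ℝ) × Z → ℝ≥0∞} {A : Finset ι} {p : Z × ℝ} :
    {u : A → ℝ | ENNReal.ofReal (Real.exp (-p.2)) < supFiber (coordProj Z A) f (u, p.1)}.Nonempty
      ↔ expWeight (fibreSup f) p ≠ 0 := by
  rw [expWeight_ne_zero_iff, lt_fibreSup_iff]
  constructor
  · rintro ⟨u, hu⟩
    obtain ⟨x, -, hx⟩ := lt_supFiber_coordProj_iff.1 hu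
    exact ⟨x, hx⟩
  · rintro ⟨x, hx⟩
    exact ⟨A.restrict x, lt_supFiber_coordProj_iff.2 ⟨x, rfl, hx⟩⟩

lemma levelVol_eq_zero {f : (ι → ℝ) × Z → ℝ≥0∞} (A : Finset ι) {p : Z × ℝ}
    (hp : expWeight (fibreSup f) p = 0) : levelVol f A p = 0 := by
  rw [levelVol, Set.not_nonempty_iff_eq_empty.1 (mt levelSet_nonempty_iff.1 (not_not.2 hp)),
    measure_empty]

/-- In dimension 0 a nonempty slice is a point of volume 1. The empty set needs this separately,
because the root of order `A.card` makes no sense there. -/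
lemma levelVol_eq_one {f : (ι → ℝ) × Z → ℝ≥0∞} {A : Finset ι} (hA : A.card = 0) {p : Z × ℝ}
    (hp : expWeight (fibreSup f) p ≠ 0) : levelVol f A p = 1 := by
  have hA' : A = ∅ := Finset.card_eq_zero.1 hA
  subst hA'
  have := (levelSet_nonempty_iff (f := f) (A := ∅) (p := p)).2 hp
  rw [levelVol, Subsingleton.eq_univ_of_nonempty this]
  simp [volume_pi]

lemma levelVol_le {f : (ι → ℝ) × Z → ℝ≥0∞} {R : ℝ} (hR : ∀ p, f p ≠ 0 → ‖p.1‖ ≤ R)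
    (A : Finset ι) (p : Z × ℝ) :
    levelVol f A p ≤ volume (Metric.closedBall (0 : A → ℝ) R) := by
  refine measure_mono fun u hu => ?_
  obtain ⟨x, rfl, hx⟩ := lt_supFiber_coordProj_iff.1 hu
  have h1 := hR (x, p.1) (ne_bot_of_gt hx)
  rw [mem_closedBall_zero_iff]
  refine le_trans ?_ h1
  exact (pi_norm_le_iff_of_nonneg (norm_nonneg x)).2 fun i => norm_le_pi_norm x i

lemma levelVol_ne_top {f : (ι → ℝ) × Z → ℝ≥0∞} {R : ℝ} (hR : ∀ p, f p ≠ 0 → ‖p.1‖ ≤ R)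
    (A : Finset ι) (p : Z × ℝ) : levelVol f A p ≠ ⊤ :=
  ne_top_of_le_ne_top measure_closedBall_lt_top.ne (levelVol_le hR A p)

/-- Superlevel sets of the log-concave projection combine convexly as `(z, r)` varies, so this is
Brunn–Minkowski in dimension `A.card`. The bound `R` keeps all volumes finite. -/
lemma levelVol_concave {f : (ι → ℝ) × Z → ℝ≥0∞} (hf : ENNLogConcave f) {R : ℝ}
    (hR : ∀ p, f p ≠ 0 → ‖p.1‖ ≤ R) {A : Finset ι} (hA : A.card ≠ 0) (p p' : Z × ℝ)
    (hp : expWeight (fibreSup f) p ≠ 0) (hp' : expWeight (fibreSup f) p' ≠ 0) (a b : ℝ)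
    (ha : 0 < a) (hb : 0 < b) (hab : a + b = 1) :
    a * (levelVol f A p).toReal ^ (A.card : ℝ)⁻¹ + b * (levelVol f A p').toReal ^ (A.card : ℝ)⁻¹
      ≤ (levelVol f A (a • p + b • p')).toReal ^ (A.card : ℝ)⁻¹ := by
  have hg := hf.supFiber (coordProj Z A)
  have hmem : ∀ p p' : Z × ℝ, ∀ a b : ℝ, 0 < a → 0 < b → a + b = 1 → ∀ u u' : A → ℝ,
      ENNReal.ofReal (Real.exp (-p.2)) < supFiber (coordProj Z A) f (u, p.1) →
      ENNReal.ofReal (Real.exp (-p'.2)) < supFiber (coordProj Z A) f (u', p'.1) →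
      ENNReal.ofReal (Real.exp (-(a • p + b • p').2)) <
        supFiber (coordProj Z A) f (a • u + b • u', (a • p + b • p').1) := by
    intro p p' a b ha hb hab u u' hu hu'
    exact hg.exp_neg_lt ha hb hab hu hu'
  have hconv : ∀ p : Z × ℝ, Convex ℝ {u : A → ℝ |
      ENNReal.ofReal (Real.exp (-p.2)) < supFiber (coordProj Z A) f (u, p.1)} := by
    intro p
    rw [convex_iff_forall_pos]
    intro u hu u' hu' a b ha hb hab
    have := hmem p p a b ha hb hab u u' hu hu'
    rwa [← add_smul, hab, one_smul] at this
  have hd : Module.finrank ℝ (A → ℝ) = A.card := by simp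
  have := Convex.brunn_minkowski (volume : Measure (A → ℝ)) (hconv p) (hconv p')
    (hconv (a • p + b • p')) (by rw [hd]; exact Nat.pos_of_ne_zero hA)
    (levelSet_nonempty_iff.2 hp) (levelSet_nonempty_iff.2 hp') (levelVol_ne_top hR A p)
    (levelVol_ne_top hR A p') (levelVol_ne_top hR A _) ha hb
    (fun u hu u' hu' => hmem p p' a b ha hb hab u u' hu hu')
  rwa [hd] at this

variable [FiniteDimensional ℝ Z] [MeasurableSpace Z] [BorelSpace Z] (μ : Measure Z)
  [μ.IsAddHaarMeasure]

lemma lintegral_withDensity_expWeight {g : Z → ℝ≥0∞} (hg : ENNLogConcave g)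
    (F : Z × ℝ → ℝ≥0∞) :
    ∫⁻ p, F p ∂((μ.prod volume).withDensity (expWeight g)) =
      ∫⁻ p, expWeight g p * F p ∂(μ.prod volume) :=
  lintegral_withDensity_eq_lintegral_mul_non_measurable₀ _ (hg.to_expWeight.aemeasurable _)
    (.of_forall fun p => (expWeight_ne_top g p).lt_top) F

lemma fibreSup_ne_top {f : (ι → ℝ) × Z → ℝ≥0∞} {C : ℝ≥0∞} (hC : C ≠ ⊤) (hfC : ∀ p, f p ≤ C)
    (z : Z) : fibreSup f z ≠ ⊤ :=
  ne_top_of_le_ne_top hC (supFiber_le_iff.2 fun p _ => hfC p)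

lemma expWeight_mul_eq {g : Z → ℝ≥0∞} {F : Z × ℝ → ℝ≥0∞}
    (hF : ∀ p, expWeight g p = 0 → F p = 0) (p : Z × ℝ) :
    expWeight g p * F p = ENNReal.ofReal (Real.exp (-p.2)) * F p := by
  by_cases hp : expWeight g p = 0
  · rw [hF p hp, mul_zero, mul_zero]
  · rw [← ne_eq, expWeight_ne_zero_iff] at hp
    rw [expWeight, Set.indicator_of_mem (by exact hp)]

lemma lintegral_supFiber_coordProj_eq {f : (ι → ℝ) × Z → ℝ≥0∞} (hf : ENNLogConcave f)
    {C : ℝ≥0∞} (hC : C ≠ ⊤) (hfC : ∀ p, f p ≤ C) (A : Finset ι) :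
    ∫⁻ p, supFiber (coordProj Z A) f p ∂(volume.prod μ) =
      ∫⁻ p, levelVol f A p ∂((μ.prod volume).withDensity (expWeight (fibreSup f))) := by
  rw [lintegral_withDensity_expWeight μ hf.to_fibreSup, (hf.supFiber
    (coordProj Z A)).lintegral_eq_lintegral_level volume μ
      (fun p => ne_top_of_le_ne_top hC (supFiber_le_iff.2 fun p _ => hfC p))]
  exact lintegral_congr fun p => (expWeight_mul_eq (F := levelVol f A) (fun p hp => levelVol_eq_zero A hp) p).symm

lemma aemeasurable_levelVol {f : (ι → ℝ) × Z → ℝ≥0∞} (hf : ENNLogConcave f) {R : ℝ}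
    (hR : ∀ p, f p ≠ 0 → ‖p.1‖ ≤ R) (A : Finset ι) :
    AEMeasurable (levelVol f A) ((μ.prod volume).withDensity (expWeight (fibreSup f))) := by
  by_cases hA : A.card = 0
  · refine (aemeasurable_const (b := (1 : ℝ≥0∞))).congr ?_
    have hm : AEMeasurable (expWeight (fibreSup f)) (μ.prod volume) :=
      hf.to_fibreSup.to_expWeight.aemeasurable _
    refine (ae_withDensity_iff' hm).2 (.of_forall fun p hp => ?_)
    exact (levelVol_eq_one hA hp).symm
  · have hA' : (A.card : ℝ)⁻¹ ≠ 0 := by positivity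
    have h1 := aemeasurable_of_concave_on_support (μ.prod (volume : Measure ℝ))
      (ρ := expWeight (fibreSup f)) (ψ := fun p => (levelVol f A p).toReal ^ (A.card : ℝ)⁻¹)
      (fun p => by positivity)
      (fun p hp => by rw [levelVol_eq_zero A hp, ENNReal.toReal_zero, Real.zero_rpow hA'])
      (levelVol_concave hf hR hA)
    have h2 : AEMeasurable (levelVol f A) (μ.prod volume) := by
      have h3 := (h1.pow_const (A.card : ℝ)).ennreal_ofReal
      convert h3 using 2 with p
      rw [← Real.rpow_mul ENNReal.toReal_nonneg, inv_mul_cancel₀ (by positivity), Real.rpow_one,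
        ENNReal.ofReal_toReal (levelVol_ne_top hR A p)]
    exact h2.mono_ac (withDensity_absolutelyContinuous _ _)

/-- Borell's inequality for `ψ = levelVol ^ (1 / A.card)` with moments `α = A.card` and `β =
Fintype.card ι`: the first is the integral of the projection, and the gamma values are factorials.
-/
lemma levelVol_borell {f : (ι → ℝ) × Z → ℝ≥0∞} (hf : ENNLogConcave f) {R : ℝ}
    (hR : ∀ p, f p ≠ 0 → ‖p.1‖ ≤ R) {C : ℝ≥0∞} (hC : C ≠ ⊤) (hfC : ∀ p, f p ≤ C)
    (hL : ∫⁻ z, fibreSup f z ∂μ ≠ ⊤) {A : Finset ι} (hA : A.card ≠ 0) :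
    ∫⁻ p, levelVol f A p ^ ((Fintype.card ι : ℝ) / A.card)
        ∂((μ.prod volume).withDensity (expWeight (fibreSup f))) ≤
      ((Fintype.card ι) ! : ℝ≥0∞) * (∫⁻ z, fibreSup f z ∂μ) *
        ((∫⁻ p, supFiber (coordProj Z A) f p ∂(volume.prod μ)) /
          ((A.card ! : ℝ≥0∞) * ∫⁻ z, fibreSup f z ∂μ)) ^ ((Fintype.card ι : ℝ) / A.card) := by
  have hA' : (A.card : ℝ)⁻¹ ≠ 0 := by positivity
  have hApos : (0 : ℝ) < A.card := by positivity
  have hMlc := hf.to_fibreSup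
  have hint := hMlc.lintegral_expWeight μ (fibreSup_ne_top hC hfC)
  have hrpow : ∀ β : ℝ, 0 ≤ β → ∀ p, ENNReal.ofReal (((levelVol f A p).toReal ^ (A.card : ℝ)⁻¹) ^ β)
      = levelVol f A p ^ (β / A.card) := by
    intro β hβ p
    rw [← Real.rpow_mul ENNReal.toReal_nonneg, ← ENNReal.ofReal_rpow_of_nonneg
      ENNReal.toReal_nonneg (by positivity), ENNReal.ofReal_toReal (levelVol_ne_top hR A p),
      inv_mul_eq_div]
  have key := hMlc.to_expWeight.borell (μ.prod (volume : Measure ℝ)) (by rwa [hint])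
    (ψ := fun p => (levelVol f A p).toReal ^ (A.card : ℝ)⁻¹) (fun p => by positivity)
    (R := (volume (Metric.closedBall (0 : A → ℝ) R)).toReal ^ (A.card : ℝ)⁻¹)
    (fun p => by
      refine Real.rpow_le_rpow ENNReal.toReal_nonneg ?_ (by positivity)
      exact ENNReal.toReal_mono measure_closedBall_lt_top.ne (levelVol_le hR A p))
    (fun p hp => by rw [levelVol_eq_zero A hp, ENNReal.toReal_zero, Real.zero_rpow hA'])
    (levelVol_concave hf hR hA) hApos
    (show (A.card : ℝ) ≤ Fintype.card ι by exact_mod_cast Finset.card_le_univ A)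
  simp_rw [hrpow _ hApos.le, hrpow _ (Nat.cast_nonneg (Fintype.card ι)), div_self hApos.ne',
    ENNReal.rpow_one, Real.Gamma_nat_eq_factorial, ENNReal.ofReal_natCast] at key
  rwa [hint, ← lintegral_supFiber_coordProj_eq μ hf hC hfC A] at key

end CoordinateProjections

/-! ### The coordinate inequality -/

section Core

lemma ENNReal.prod_rpow_const {κ : Type*} (s : Finset κ) (x : ℝ≥0∞) {θ : κ → ℝ}
    (hθ : ∀ j, 0 ≤ θ j) : ∏ j ∈ s, x ^ θ j = x ^ ∑ j ∈ s, θ j := by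
  classical
  induction s using Finset.induction with
  | empty => simp
  | insert i s hi ih =>
    rw [Finset.prod_insert hi, Finset.sum_insert hi, ih,
      ENNReal.rpow_add_of_nonneg _ _ (hθ i) (Finset.sum_nonneg fun j _ => hθ j)]

variable {ι κ Z : Type*} [Fintype ι] [DecidableEq ι] [Fintype κ]
  [NormedAddCommGroup Z] [NormedSpace ℝ Z] [FiniteDimensional ℝ Z] [MeasurableSpace Z]
  [BorelSpace Z] (μ : Measure Z) [μ.IsAddHaarMeasure]

lemma sum_weight_mul_card {T : κ → Finset ι} {q : κ → ℝ}
    (hcover : ∀ i, ∑ j, q j * (if i ∈ T j then 1 else 0) = 1) :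
    ∑ j, q j * (T j).card = Fintype.card ι := by
  have h1 : ∑ i : ι, ∑ j, q j * (if i ∈ T j then (1 : ℝ) else 0) = Fintype.card ι := by
    rw [Finset.sum_congr rfl fun i _ => hcover i]
    simp
  rw [← h1, Finset.sum_comm]
  refine Finset.sum_congr rfl fun j _ => ?_
  rw [← Finset.mul_sum]
  simp

lemma one_le_sum_weight [Nonempty ι] {T : κ → Finset ι} {q : κ → ℝ} (hq : ∀ j, 0 < q j)
    (hcover : ∀ i, ∑ j, q j * (if i ∈ T j then 1 else 0) = 1) : 1 ≤ ∑ j, q j := by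
  obtain ⟨i⟩ := ‹Nonempty ι›
  rw [← hcover i]
  refine Finset.sum_le_sum fun j _ => ?_
  split_ifs
  · simp
  · simpa using (hq j).le

/-- Bollobás–Thomason on each slice: the projection of a slice of `f` lies in the corresponding
slice of the projection of `f`. -/
lemma lintegral_le_lintegral_prod_levelVol {f : (ι → ℝ) × Z → ℝ≥0∞} (hf : ENNLogConcave f)
    {C : ℝ≥0∞} (hC : C ≠ ⊤) (hfC : ∀ p, f p ≤ C) {T : κ → Finset ι} {q : κ → ℝ}
    (hq : ∀ j, 0 < q j) (hcover : ∀ i, ∑ j, q j * (if i ∈ T j then 1 else 0) = 1) :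
    ∫⁻ p, f p ∂(volume.prod μ) ≤ ∫⁻ p, ∏ j, levelVol f (T j) p ^ q j
      ∂((μ.prod volume).withDensity (expWeight (fibreSup f))) := by
  rw [lintegral_withDensity_expWeight μ hf.to_fibreSup,
    hf.lintegral_eq_lintegral_level volume μ fun p => ne_top_of_le_ne_top hC (hfC p)]
  refine lintegral_mono fun p => ?_
  by_cases hp : expWeight (fibreSup f) p = 0
  · have : {u : ι → ℝ | ENNReal.ofReal (Real.exp (-p.2)) < f (u, p.1)} = ∅ := by
      rw [Set.eq_empty_iff_forall_notMem]
      intro u hu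
      exact expWeight_ne_zero_iff.2 (lt_fibreSup_iff.2 ⟨u, hu⟩) hp
    rw [this, measure_empty, mul_zero]
    exact zero_le
  · have hp' := expWeight_ne_zero_iff.1 hp
    have hw : expWeight (fibreSup f) p = ENNReal.ofReal (Real.exp (-p.2)) := by
      rw [expWeight, Set.indicator_of_mem (by exact hp')]
    rw [hw]
    gcongr
    refine (volume_le_prod_volume_image_restrict_rpow (fun j => (hq j).le) hcover _).trans ?_
    refine Finset.prod_le_prod' fun j _ => ENNReal.rpow_le_rpow (measure_mono ?_) (hq j).le
    rintro _ ⟨x, hx, rfl⟩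
    exact lt_supFiber_coordProj_iff.2 ⟨x, rfl, hx⟩

lemma lintegral_levelVol_rpow_le [Nonempty ι] {f : (ι → ℝ) × Z → ℝ≥0∞} (hf : ENNLogConcave f)
    {R : ℝ} (hR : ∀ p, f p ≠ 0 → ‖p.1‖ ≤ R) {C : ℝ≥0∞} (hC : C ≠ ⊤) (hfC : ∀ p, f p ≤ C)
    (hL0 : ∫⁻ z, fibreSup f z ∂μ ≠ 0) (hL : ∫⁻ z, fibreSup f z ∂μ ≠ ⊤) (A : Finset ι) {t : ℝ}
    (ht : 0 < t) :
    (∫⁻ p, levelVol f A p ^ ((Fintype.card ι : ℝ) / A.card)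
        ∂((μ.prod volume).withDensity (expWeight (fibreSup f)))) ^
          (t * A.card / Fintype.card ι) ≤
      (((Fintype.card ι) ! : ℝ≥0∞) * (∫⁻ z, fibreSup f z ∂μ)) ^ (t * A.card / Fintype.card ι) *
        ((∫⁻ p, supFiber (coordProj Z A) f p ∂(volume.prod μ)) /
          ((A.card ! : ℝ≥0∞) * ∫⁻ z, fibreSup f z ∂μ)) ^ t := by
  by_cases hA : A.card = 0
  -- For empty `A`, division by 0 makes the exponent of `levelVol` equal to 0, and the outer
  -- exponents with factor `A.card` vanish as well. It remains that the projection has integral `L`,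
  -- so the last quotient is 1.
  · have h1 : ∫⁻ p, supFiber (coordProj Z A) f p ∂(volume.prod μ) = ∫⁻ z, fibreSup f z ∂μ := by
      rw [lintegral_supFiber_coordProj_eq μ hf hC hfC, lintegral_withDensity_expWeight μ
        hf.to_fibreSup, ← hf.to_fibreSup.lintegral_expWeight μ (fibreSup_ne_top hC hfC)]
      refine lintegral_congr fun p => ?_
      by_cases hp : expWeight (fibreSup f) p = 0
      · rw [hp, zero_mul]
      · rw [levelVol_eq_one hA hp, mul_one]
    rw [h1]
    simp [hA, ENNReal.div_self hL0 hL]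
  · have hd : (0 : ℝ) < Fintype.card ι := by exact_mod_cast Fintype.card_pos
    have hA' : (0 : ℝ) < A.card := by positivity
    refine (ENNReal.rpow_le_rpow (levelVol_borell μ hf hR hC hfC hL hA) (by positivity)).trans
      (le_of_eq ?_)
    rw [ENNReal.mul_rpow_of_nonneg _ _ (by positivity), ← ENNReal.rpow_mul]
    congr 2
    field_simp

lemma lintegral_le_prod_of_bounded [Nonempty ι] {f : (ι → ℝ) × Z → ℝ≥0∞} (hf : ENNLogConcave f)
    {R : ℝ} (hR : ∀ p, f p ≠ 0 → ‖p.1‖ ≤ R) {C : ℝ≥0∞} (hC : C ≠ ⊤) (hfC : ∀ p, f p ≤ C)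
    (hL0 : ∫⁻ z, fibreSup f z ∂μ ≠ 0) (hL : ∫⁻ z, fibreSup f z ∂μ ≠ ⊤)
    {T : κ → Finset ι} {q : κ → ℝ} (hq : ∀ j, 0 < q j)
    (hcover : ∀ i, ∑ j, q j * (if i ∈ T j then 1 else 0) = 1) :
    ∫⁻ p, f p ∂(volume.prod μ) ≤ ((Fintype.card ι) ! : ℝ≥0∞) * (∫⁻ z, fibreSup f z ∂μ) *
      ∏ j, ((∫⁻ p, supFiber (coordProj Z (T j)) f p ∂(volume.prod μ)) /
          (((T j).card ! : ℝ≥0∞) * ∫⁻ z, fibreSup f z ∂μ)) ^ q j := by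
  have hd : (0 : ℝ) < Fintype.card ι := by exact_mod_cast Fintype.card_pos
  -- Hölder exponents, chosen so that `(d / d_j) * θ j = q j` when `d_j ≠ 0`. Their sum is 1 because
  -- counting the cover twice gives `∑ q j * d_j = d`.
  set θ : κ → ℝ := fun j => q j * (T j).card / Fintype.card ι with hθ
  have hθ0 : ∀ j, 0 ≤ θ j := fun j => by have := hq j; positivity
  have hθ1 : ∑ j, θ j = 1 := by
    rw [hθ, ← Finset.sum_div, sum_weight_mul_card hcover, div_self hd.ne']
  set ν := (μ.prod volume).withDensity (expWeight (fibreSup f)) with hν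
  calc ∫⁻ p, f p ∂(volume.prod μ) ≤ ∫⁻ p, ∏ j, levelVol f (T j) p ^ q j ∂ν :=
        lintegral_le_lintegral_prod_levelVol μ hf hC hfC hq hcover
    _ = ∫⁻ p, ∏ j, (levelVol f (T j) p ^ ((Fintype.card ι : ℝ) / (T j).card)) ^ θ j ∂ν := by
        rw [hν, lintegral_withDensity_expWeight μ hf.to_fibreSup,
          lintegral_withDensity_expWeight μ hf.to_fibreSup]
        refine lintegral_congr fun p => ?_
        by_cases hp : expWeight (fibreSup f) p = 0
        · rw [hp, zero_mul, zero_mul]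
        congr 1
        refine Finset.prod_congr rfl fun j _ => ?_
        by_cases hj : (T j).card = 0
        · rw [levelVol_eq_one hj hp]
          simp
        · have hj' : ((T j).card : ℝ) ≠ 0 := by positivity
          rw [← ENNReal.rpow_mul]
          congr 1
          simp only [hθ]
          field_simp
    _ ≤ ∏ j, (∫⁻ p, levelVol f (T j) p ^ ((Fintype.card ι : ℝ) / (T j).card) ∂ν) ^ θ j :=
        ENNReal.lintegral_prod_norm_pow_le _
          (fun j _ => (aemeasurable_levelVol μ hf hR (T j)).pow_const _) hθ1 fun j _ => hθ0 j
    _ ≤ ∏ j, ((((Fintype.card ι) ! : ℝ≥0∞) * (∫⁻ z, fibreSup f z ∂μ)) ^ θ j *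
        ((∫⁻ p, supFiber (coordProj Z (T j)) f p ∂(volume.prod μ)) /
          (((T j).card ! : ℝ≥0∞) * ∫⁻ z, fibreSup f z ∂μ)) ^ q j) :=
        Finset.prod_le_prod' fun j _ =>
          lintegral_levelVol_rpow_le μ hf hR hC hfC hL0 hL (T j) (hq j)
    _ = _ := by
        rw [Finset.prod_mul_distrib, ENNReal.prod_rpow_const _ _ hθ0, hθ1, ENNReal.rpow_one]

lemma lintegral_eq_zero_of_fibreSup {f : (ι → ℝ) × Z → ℝ≥0∞} (hf : ENNLogConcave f)
    (h : ∫⁻ z, fibreSup f z ∂μ = 0) : ∫⁻ p, f p ∂(volume.prod μ) = 0 := by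
  rw [lintegral_eq_zero_iff' (hf.to_fibreSup.aemeasurable μ)] at h
  rw [lintegral_prod_symm _ (hf.aemeasurable _), ← nonpos_iff_eq_zero]
  calc ∫⁻ z, ∫⁻ x, f (x, z) ∂volume ∂μ = ∫⁻ z, 0 ∂μ := by
        refine lintegral_congr_ae ?_
        filter_upwards [h] with z hz
        rw [← nonpos_iff_eq_zero]
        calc ∫⁻ x, f (x, z) ≤ ∫⁻ x : ι → ℝ, 0 := by
              refine lintegral_mono fun x => ?_
              exact (le_supFiber (LinearMap.snd ℝ (ι → ℝ) Z) f (x, z)).trans hz.le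
          _ = 0 := by simp
    _ ≤ 0 := by simp

lemma fibreSup_rpow_mul_lintegral_le_of_bounded [Nonempty ι] {f : (ι → ℝ) × Z → ℝ≥0∞}
    (hf : ENNLogConcave f) {R : ℝ} (hR : ∀ p, f p ≠ 0 → ‖p.1‖ ≤ R) {C : ℝ≥0∞} (hC : C ≠ ⊤)
    (hfC : ∀ p, f p ≤ C) (hL : ∫⁻ z, fibreSup f z ∂μ ≠ ⊤)
    {T : κ → Finset ι} {q : κ → ℝ} (hq : ∀ j, 0 < q j)
    (hcover : ∀ i, ∑ j, q j * (if i ∈ T j then 1 else 0) = 1) :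
    (∫⁻ z, fibreSup f z ∂μ) ^ (∑ j, q j - 1) * ∫⁻ p, f p ∂(volume.prod μ) ≤
      ((Fintype.card ι) ! : ℝ≥0∞) * (∏ j, ((T j).card ! : ℝ≥0∞) ^ q j)⁻¹ *
      ∏ j, (∫⁻ p, supFiber (coordProj Z (T j)) f p ∂(volume.prod μ)) ^ q j := by
  by_cases hL0 : ∫⁻ z, fibreSup f z ∂μ = 0
  · rw [lintegral_eq_zero_of_fibreSup μ hf hL0, mul_zero]
    exact zero_le
  set L := ∫⁻ z, fibreSup f z ∂μ with hLdef
  have key := lintegral_le_prod_of_bounded μ hf hR hC hfC hL0 hL hq hcover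
  rw [← hLdef] at key
  have hp := one_le_sum_weight hq hcover
  have hLp0 : L ^ ∑ j, q j ≠ 0 := by simp [ENNReal.rpow_eq_zero_iff, hL0, hL]
  have hLp : L ^ ∑ j, q j ≠ ⊤ := ENNReal.rpow_ne_top_of_nonneg (by linarith) hL
  have hfac : ∀ j, ((T j).card ! : ℝ≥0∞) ^ q j ≠ 0 := fun j => by
    simp [ENNReal.rpow_eq_zero_iff, Nat.factorial_ne_zero]
  have hfac' : ∀ j, ((T j).card ! : ℝ≥0∞) ^ q j ≠ ⊤ := fun j =>
    ENNReal.rpow_ne_top_of_nonneg (hq j).le (ENNReal.natCast_ne_top _)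
  have hprod : ∏ j, ((∫⁻ p, supFiber (coordProj Z (T j)) f p ∂(volume.prod μ)) /
          (((T j).card ! : ℝ≥0∞) * L)) ^ q j =
      (∏ j, (∫⁻ p, supFiber (coordProj Z (T j)) f p ∂(volume.prod μ)) ^ q j) *
        (∏ j, ((T j).card ! : ℝ≥0∞) ^ q j)⁻¹ * (L ^ ∑ j, q j)⁻¹ := by
    rw [← ENNReal.prod_rpow_const _ _ fun j => (hq j).le, ENNReal.prod_inv_distrib,
      ENNReal.prod_inv_distrib, ← Finset.prod_mul_distrib, ← Finset.prod_mul_distrib]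
    · refine Finset.prod_congr rfl fun j _ => ?_
      rw [ENNReal.div_rpow_of_nonneg _ _ (hq j).le, ENNReal.mul_rpow_of_nonneg _ _ (hq j).le,
        div_eq_mul_inv, ENNReal.mul_inv (.inl (hfac j)) (.inl (hfac' j)), mul_assoc]
    · intro i _ j _ _
      exact .inl (by simp [ENNReal.rpow_eq_zero_iff, hL0, hL])
    · intro i _ j _ _
      exact .inl (hfac i)
  rw [hprod] at key
  refine (mul_le_mul_right key _).trans (le_of_eq ?_)
  -- The powers of `L` cancel: `p - 1` from the left side, one from the mass, and `-p` from the
  -- quotients.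
  calc _ = (L ^ (∑ j, q j - 1) * L) * (L ^ ∑ j, q j)⁻¹ * (((Fintype.card ι) ! : ℝ≥0∞) *
      (∏ j, ((T j).card ! : ℝ≥0∞) ^ q j)⁻¹ *
      ∏ j, (∫⁻ p, supFiber (coordProj Z (T j)) f p ∂(volume.prod μ)) ^ q j) := by ring
    _ = _ := by
        have : L ^ (∑ j, q j - 1) * L = L ^ ∑ j, q j := by
          conv_lhs => rw [← ENNReal.rpow_one L, ← ENNReal.rpow_mul, one_mul]
          rw [← ENNReal.rpow_add _ _ hL0 hL, sub_add_cancel]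
        rw [this, ENNReal.mul_inv_cancel hLp0 hLp, one_mul]

/-- The truncation of `f` at height `k`, restricted to the ball of radius `k`. -/
noncomputable def truncation {X : Type*} [NormedAddCommGroup X] (f : X → ℝ≥0∞) (k : ℕ) :
    X → ℝ≥0∞ :=
  (Metric.closedBall (0 : X) k).indicator fun x => min (f x) k

lemma iSup_truncation {X : Type*} [NormedAddCommGroup X] (f : X → ℝ≥0∞) (x : X) :
    ⨆ k, truncation f k x = f x := by
  apply le_antisymm
  · refine iSup_le fun k => Set.indicator_le_self' (fun _ _ => zero_le) x |>.trans (min_le_left _ _)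
  · conv_lhs => rw [← ENNReal.iSup_min_natCast (f x)]
    refine iSup_le fun k => ?_
    refine le_trans ?_ (le_iSup _ (max k ⌈‖x‖⌉₊))
    rw [truncation, Set.indicator_of_mem]
    · exact min_le_min_left _ (by exact_mod_cast le_max_left _ _)
    · rw [mem_closedBall_zero_iff]
      exact (Nat.le_ceil _).trans (by exact_mod_cast le_max_right _ _)

lemma truncation_mono {X : Type*} [NormedAddCommGroup X] (f : X → ℝ≥0∞) (x : X) :
    Monotone fun k => truncation f k x := by
  intro k l hkl
  have hkl' : (k : ℝ) ≤ l := by exact_mod_cast hkl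
  dsimp only [truncation]
  by_cases hx : x ∈ Metric.closedBall (0 : X) k
  · rw [Set.indicator_of_mem hx,
      Set.indicator_of_mem (Metric.closedBall_subset_closedBall hkl' hx)]
    exact min_le_min_left _ (by exact_mod_cast hkl)
  · rw [Set.indicator_of_notMem hx]
    exact zero_le

lemma ENNLogConcave.to_truncation {X : Type*} [NormedAddCommGroup X] [NormedSpace ℝ X]
    {f : X → ℝ≥0∞} (hf : ENNLogConcave f) (k : ℕ) : ENNLogConcave (truncation f k) :=
  (hf.min_const _).indicator (convex_closedBall _ _)

/-- The coordinate form of the dual local Loomis–Whitney inequality. -/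
lemma fibreSup_rpow_mul_lintegral_le [Nonempty ι] {f : (ι → ℝ) × Z → ℝ≥0∞}
    (hf : ENNLogConcave f) {T : κ → Finset ι} {q : κ → ℝ} (hq : ∀ j, 0 < q j)
    (hcover : ∀ i, ∑ j, q j * (if i ∈ T j then 1 else 0) = 1) :
    (∫⁻ z, fibreSup f z ∂μ) ^ (∑ j, q j - 1) * ∫⁻ p, f p ∂(volume.prod μ) ≤
      ((Fintype.card ι) ! : ℝ≥0∞) * (∏ j, ((T j).card ! : ℝ≥0∞) ^ q j)⁻¹ *
      ∏ j, (∫⁻ p, supFiber (coordProj Z (T j)) f p ∂(volume.prod μ)) ^ q j := by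
  have hp : 0 ≤ ∑ j, q j - 1 := sub_nonneg.2 (one_le_sum_weight hq hcover)
  have hsup : ∀ z, fibreSup f z = ⨆ k, fibreSup (truncation f k) z := by
    intro z
    have : f = fun x => ⨆ k, truncation f k x := funext fun x => (iSup_truncation f x).symm
    conv_lhs => rw [fibreSup, this]
    exact supFiber_iSup _ _ z
  have hmonoM : ∀ z, Monotone fun k => fibreSup (truncation f k) z := fun z k l hkl =>
    supFiber_mono _ (fun x => truncation_mono f x hkl) z
  have h1 : ∫⁻ z, fibreSup f z ∂μ = ⨆ k, ∫⁻ z, fibreSup (truncation f k) z ∂μ := by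
    simp_rw [hsup]
    exact lintegral_iSup' (fun k => (hf.to_truncation k).to_fibreSup.aemeasurable μ)
      (.of_forall hmonoM)
  have h2 : ∫⁻ p, f p ∂(volume.prod μ) = ⨆ k, ∫⁻ p, truncation f k p ∂(volume.prod μ) := by
    rw [← lintegral_iSup' (fun k => (hf.to_truncation k).aemeasurable _)
      (.of_forall fun x => truncation_mono f x)]
    simp_rw [iSup_truncation]
  -- The truncations are bounded with bounded support and increase to `f`. As `p - 1 ≥ 0`, the left
  -- side is the supremum of its truncated versions, and the right side only grows.
  rw [h1, h2, ENNReal.iSup_rpow_of_nonneg _ hp, ENNReal.iSup_mul_iSup_of_monotone_nat]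
  · refine iSup_le fun k => ?_
    have hnz : ∀ p : (ι → ℝ) × Z, truncation f k p ≠ 0 → ‖p‖ ≤ k := fun p hp => by
      rw [← mem_closedBall_zero_iff]
      exact Set.mem_of_indicator_ne_zero hp
    have hle : ∀ p : (ι → ℝ) × Z, truncation f k p ≤ k := fun p =>
      Set.indicator_le_self' (fun _ _ => zero_le) p |>.trans (min_le_right _ _)
    refine (fibreSup_rpow_mul_lintegral_le_of_bounded μ (hf.to_truncation k) (R := k)
      (fun p hp => (norm_fst_le p).trans (hnz p hp)) (ENNReal.natCast_ne_top k) hle ?_ hq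
      hcover).trans ?_
    · refine ne_top_of_le_ne_top ?_ (lintegral_mono
        (g := (Metric.closedBall (0 : Z) k).indicator fun _ => (k : ℝ≥0∞)) fun z => ?_)
      · rw [lintegral_indicator_const Metric.isClosed_closedBall.measurableSet]
        exact ENNReal.mul_ne_top (ENNReal.natCast_ne_top k) measure_closedBall_lt_top.ne
      · refine supFiber_le_iff.2 ?_
        rintro p rfl
        by_cases h0 : truncation f k p = 0
        · rw [h0]; exact zero_le
        · rw [Set.indicator_of_mem]
          · exact hle p
          · rw [mem_closedBall_zero_iff]
            exact (norm_snd_le p).trans (hnz p h0)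
    · gcongr with j
      · exact (hq j).le
      · refine supFiber_mono _ (fun x => ?_) _
        exact (le_iSup (fun k => truncation f k x) k).trans (iSup_truncation f x).le
  · intro k l hkl
    exact ENNReal.rpow_le_rpow (lintegral_mono fun z => hmonoM z hkl) hp
  · intro k l hkl
    exact lintegral_mono fun x => truncation_mono f x hkl

end Core

/-! ### Gram determinants as Jacobians -/

section Gram

variable {β : Type*} [Fintype β] [DecidableEq β]

lemma lintegral_comp_toLin' {M : Matrix β β ℝ} (hM : M.det ≠ 0) {g : (β → ℝ) → ℝ≥0∞}
    (hg : AEMeasurable g volume) :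
    ENNReal.ofReal |M.det| * ∫⁻ c, g (Matrix.toLin' M c) = ∫⁻ u, g u := by
  have h1 := Real.map_matrix_volume_pi_eq_smul_volume_pi hM
  have hm : Measurable (Matrix.toLin' M) :=
    (LinearMap.continuous_on_pi (Matrix.toLin' M)).measurable
  have h2 : AEMeasurable g (Measure.map (Matrix.toLin' M) volume) := by
    rw [h1]; exact hg.smul_measure _
  rw [← lintegral_map' h2 hm.aemeasurable, h1, lintegral_smul_measure, smul_eq_mul, ← mul_assoc,
    ← ENNReal.ofReal_mul (abs_nonneg _), ← abs_mul, mul_inv_cancel₀ hM]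
  simp

section Space

variable {F : Type*} [NormedAddCommGroup F] [InnerProductSpace ℝ F] [FiniteDimensional ℝ F]

lemma exists_orthonormalBasis_of_card_eq (hd : Module.finrank ℝ F = Fintype.card β) :
    Nonempty (OrthonormalBasis β ℝ F) :=
  ⟨(stdOrthonormalBasis ℝ F).reindex (Fintype.equivOfCardEq (by simp [hd]))⟩

lemma abs_det_coords_eq_sqrt_det_gram (o : OrthonormalBasis β ℝ F) (v : β → F) :
    |(Matrix.of fun i j => (o.repr (v j)) i).det| = Real.sqrt (Matrix.gram ℝ v).det := by
  rw [Matrix.gram_eq_conjTranspose_mul o v, Matrix.det_mul, Matrix.det_conjTranspose, star_trivial,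
    Real.sqrt_mul_self_eq_abs]

variable [MeasurableSpace F] [BorelSpace F]

lemma volume_parallelepiped_eq_sqrt_det_gram (hd : Module.finrank ℝ F = Fintype.card β)
    (v : β → F) :
    volume (parallelepiped v) = ENNReal.ofReal (Real.sqrt (Matrix.gram ℝ v).det) := by
  obtain ⟨o⟩ := exists_orthonormalBasis_of_card_eq hd
  rw [← o.addHaar_eq_volume, Measure.addHaar_parallelepiped, ← abs_det_coords_eq_sqrt_det_gram o v]
  rfl

/-- In an orthonormal basis the map `x ↦ (⟪v b, x⟫)` has matrix `Mᵀ`, where `M` has the coordinates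
of the `v b` as columns, and `|det M|` is the root of the Gram determinant. -/
lemma lintegral_inner_coords (hd : Module.finrank ℝ F = Fintype.card β) {v : β → F}
    (hv : LinearIndependent ℝ v) {g : (β → ℝ) → ℝ≥0∞} (hg : AEMeasurable g volume) :
    ENNReal.ofReal (Real.sqrt (Matrix.gram ℝ v).det) * ∫⁻ x : F, g (fun b => inner ℝ (v b) x) =
      ∫⁻ u, g u := by
  obtain ⟨o⟩ := exists_orthonormalBasis_of_card_eq hd
  set M : Matrix β β ℝ := Matrix.of fun i j => (o.repr (v j)) i with hM
  have habs : |M.det| = Real.sqrt (Matrix.gram ℝ v).det := abs_det_coords_eq_sqrt_det_gram o v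
  have hgram : 0 < (Matrix.gram ℝ v).det := (Matrix.posDef_gram_of_linearIndependent hv).det_pos
  have hdet : M.det ≠ 0 := by
    rw [← abs_pos, habs]; exact Real.sqrt_pos.2 hgram
  have hmp := (PiLp.volume_preserving_ofLp β).comp o.measurePreserving_repr
  have hcoord : ∀ x : F, (fun b => inner ℝ (v b) x) =
      Matrix.toLin' M.transpose ((WithLp.ofLp ∘ o.repr) x) := by
    intro x
    funext b
    rw [Matrix.toLin'_apply, Matrix.mulVec, dotProduct, ← o.repr.inner_map_map (v b) x,
      PiLp.inner_apply]
    refine Finset.sum_congr rfl fun i _ => ?_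
    simp [hM, mul_comm]
  rw [← lintegral_comp_toLin' (M := M.transpose) (by rwa [Matrix.det_transpose]) hg,
    Matrix.det_transpose, habs]
  congr 1
  simp_rw [hcoord]
  refine hmp.lintegral_comp_emb ?_ fun c => g (Matrix.toLin' M.transpose c)
  exact ((MeasurableEquiv.toLp 2 (β → ℝ)).symm.measurableEmbedding).comp
    o.repr.toHomeomorph.measurableEmbedding

end Space

end Gram

/-! ### Parallelepiped volumes and projections of f in inner-product coordinates -/

section Wedge

variable {n : ℕ}

lemma spanOn_eq_span_range (w : Fin n → EuclideanSpace ℝ (Fin n)) (A : Finset (Fin n)) :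
    spanOn w A = Submodule.span ℝ (Set.range fun k : A => w k) := by
  rw [spanOn, Set.image_eq_range]; rfl

lemma mem_spanOn (w : Fin n → EuclideanSpace ℝ (Fin n)) {A : Finset (Fin n)} (k : A) :
    w k ∈ spanOn w A :=
  Submodule.subset_span ⟨k, k.2, rfl⟩

lemma finrank_spanOn {w : Fin n → EuclideanSpace ℝ (Fin n)} (hw : LinearIndependent ℝ w)
    (A : Finset (Fin n)) : Module.finrank ℝ (spanOn w A) = A.card := by
  rw [spanOn_eq_span_range, finrank_span_eq_card (b := fun k : A => w k) (hw.comp _ Subtype.val_injective),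
    Fintype.card_coe]

lemma wedgeVol_eq_sqrt_det_gram {w : Fin n → EuclideanSpace ℝ (Fin n)} (hw : LinearIndependent ℝ w)
    (A : Finset (Fin n)) :
    wedgeVol w A = Real.sqrt (Matrix.gram ℝ fun k : A => w k).det := by
  set v : A → spanOn w A := fun k => ⟨w k, mem_spanOn w k⟩ with hv
  have h1 : {x : spanOn w A | (x : EuclideanSpace ℝ (Fin n)) ∈ parallelepiped (fun k : A => w k)}
      = parallelepiped v := by
    have h2 := image_parallelepiped (spanOn w A).subtype v
    have h3 : ⇑(spanOn w A).subtype ∘ v = fun k : A => w k := rfl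
    rw [h3] at h2
    rw [← h2]
    exact Set.preimage_image_eq _ Subtype.val_injective
  rw [wedgeVol, h1, volume_parallelepiped_eq_sqrt_det_gram (by simp [finrank_spanOn hw]),
    ENNReal.toReal_ofReal (Real.sqrt_nonneg _)]
  rfl

lemma wedgeVol_pos {w : Fin n → EuclideanSpace ℝ (Fin n)} (hw : LinearIndependent ℝ w)
    (A : Finset (Fin n)) : 0 < wedgeVol w A := by
  rw [wedgeVol_eq_sqrt_det_gram hw]
  exact Real.sqrt_pos.2
    (Matrix.posDef_gram_of_linearIndependent (hw.comp _ Subtype.val_injective)).det_pos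

lemma wedgeVol_eq_of_equiv {w : Fin n → EuclideanSpace ℝ (Fin n)} (hw : LinearIndependent ℝ w)
    {A : Finset (Fin n)} {β : Type*} [Fintype β] [DecidableEq β] (e : β ≃ A) :
    wedgeVol w A = Real.sqrt (Matrix.gram ℝ fun b => w (e b)).det := by
  rw [wedgeVol_eq_sqrt_det_gram hw, ← Matrix.det_submatrix_equiv_self e]
  rfl

lemma IsLogConcave.ennLogConcave {f : EuclideanSpace ℝ (Fin n) → ℝ} (hf : IsLogConcave f) :
    ENNLogConcave fun x => ENNReal.ofReal (f x) := by
  intro x y a b ha hb hab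
  rw [ENNReal.ofReal_rpow_of_nonneg (hf.nonneg x) ha.le,
    ENNReal.ofReal_rpow_of_nonneg (hf.nonneg y) hb.le,
    ← ENNReal.ofReal_mul (Real.rpow_nonneg (hf.nonneg x) _)]
  exact ENNReal.ofReal_le_ofReal (hf.rpow_mul_rpow_le x y a b ha hb hab)

/-- The inner products with a family of vectors, as a linear map. -/
noncomputable def innerCoords {β : Type*} (v : β → EuclideanSpace ℝ (Fin n)) :
    EuclideanSpace ℝ (Fin n) →ₗ[ℝ] (β → ℝ) :=
  LinearMap.pi fun b => innerₗ (EuclideanSpace ℝ (Fin n)) (v b)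

lemma innerCoords_apply {β : Type*} (v : β → EuclideanSpace ℝ (Fin n))
    (x : EuclideanSpace ℝ (Fin n)) (b : β) : innerCoords v x b = inner ℝ (v b) x := rfl

/-- The fibres of `innerCoords v` are the cosets of `Kᗮ`. -/
lemma projFun_eq_supFiber {β : Type*} {v : β → EuclideanSpace ℝ (Fin n)}
    {K : Submodule ℝ (EuclideanSpace ℝ (Fin n))} (hK : K = Submodule.span ℝ (Set.range v))
    (f : EuclideanSpace ℝ (Fin n) → ℝ) (x : K) :
    projFun K f x = supFiber (innerCoords v) (fun x => ENNReal.ofReal (f x))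
      (innerCoords v (x : EuclideanSpace ℝ (Fin n))) := by
  apply le_antisymm
  · refine iSup_le fun y => ?_
    have h1 : innerCoords v ((x : EuclideanSpace ℝ (Fin n)) + y) = innerCoords v x := by
      funext b
      rw [map_add, Pi.add_apply, innerCoords_apply v (y : EuclideanSpace ℝ (Fin n)),
        (Submodule.mem_orthogonal _ _).1 y.2 (v b) (hK ▸ Submodule.subset_span ⟨b, rfl⟩), add_zero]
    rw [← h1]
    exact le_supFiber (innerCoords v) (fun x => ENNReal.ofReal (f x)) _
  · refine supFiber_le_iff.2 fun z hz => ?_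
    have h1 : z - x ∈ Kᗮ := by
      rw [Submodule.mem_orthogonal]
      intro u hu
      rw [hK] at hu
      induction hu using Submodule.span_induction with
      | mem u hu =>
        obtain ⟨b, rfl⟩ := hu
        rw [inner_sub_right, ← innerCoords_apply, ← innerCoords_apply, hz, sub_self]
      | zero => simp
      | add a b _ _ ha hb => rw [inner_add_left, ha, hb, add_zero]
      | smul c a _ ha => rw [inner_smul_left, ha, mul_zero]
    have h2 := le_iSup (fun y : Kᗮ => ENNReal.ofReal (f ((x : EuclideanSpace ℝ (Fin n)) +
      (y : EuclideanSpace ℝ (Fin n))))) ⟨z - x, h1⟩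
    simpa [projFun] using h2

lemma lintegral_supFiber_innerCoords {w : Fin n → EuclideanSpace ℝ (Fin n)}
    (hw : LinearIndependent ℝ w) {f : EuclideanSpace ℝ (Fin n) → ℝ} (hf : IsLogConcave f)
    {A : Finset (Fin n)} {β : Type*} [Fintype β] [DecidableEq β] (e : β ≃ A) :
    ∫⁻ u, supFiber (innerCoords fun b => w (e b)) (fun x => ENNReal.ofReal (f x)) u =
      ENNReal.ofReal (wedgeVol w A) * projNorm (spanOn w A) f := by
  set v : β → spanOn w A := fun b => ⟨w (e b), mem_spanOn w (e b)⟩ with hv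
  have hvli : LinearIndependent ℝ v := by
    refine LinearIndependent.of_comp (spanOn w A).subtype ?_
    exact hw.comp _ (Subtype.val_injective.comp e.injective)
  have hd : Module.finrank ℝ (spanOn w A) = Fintype.card β := by
    rw [finrank_spanOn hw, Fintype.card_congr e, Fintype.card_coe]
  have hspan : spanOn w A = Submodule.span ℝ (Set.range fun b => w (e b)) := by
    rw [spanOn_eq_span_range]
    congr 1
    exact (e.surjective.range_comp fun k : A => w k).symm
  have hg := (hf.ennLogConcave.supFiber (innerCoords fun b => w (e b))).aemeasurable volume
  rw [← lintegral_inner_coords hd hvli hg, wedgeVol_eq_of_equiv hw e, projNorm]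
  simp_rw [projFun_eq_supFiber hspan f]
  rfl

end Wedge

/-! ### The inequality for an arbitrary basis -/

section Basis

variable {n m : ℕ}

lemma supFiber_comp_equiv {X Y V : Type*} (e : X ≃ Y) (π : Y → V) (f : X → ℝ≥0∞) :
    supFiber π (fun y => f (e.symm y)) = supFiber (fun x => π (e x)) f := by
  funext v
  apply le_antisymm
  · refine supFiber_le_iff.2 fun y hy => ?_
    subst hy
    convert le_supFiber (fun x => π (e x)) f (e.symm y) using 2
    simp
  · refine supFiber_le_iff.2 fun x hx => ?_
    subst hx
    simpa using le_supFiber π (fun y => f (e.symm y)) (e x)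

lemma supFiber_id {X : Type*} (f : X → ℝ≥0∞) (x : X) : supFiber id f x = f x :=
  le_antisymm (supFiber_le_iff.2 fun z hz => by rw [← hz, id]) (le_supFiber id f x)

lemma projNorm_top (f : EuclideanSpace ℝ (Fin n) → ℝ) :
    projNorm ⊤ f = ∫⁻ x, ENNReal.ofReal (f x) := by
  have h1 : ∀ x : (⊤ : Submodule ℝ (EuclideanSpace ℝ (Fin n))),
      projFun ⊤ f x = ENNReal.ofReal (f x) := by
    intro x
    have h2 : ∀ y : (⊤ : Submodule ℝ (EuclideanSpace ℝ (Fin n)))ᗮ,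
        (y : EuclideanSpace ℝ (Fin n)) = 0 := fun y => by
      have hb : (⊤ : Submodule ℝ (EuclideanSpace ℝ (Fin n)))ᗮ = ⊥ :=
        Submodule.top_orthogonal_eq_bot
      exact (Submodule.mem_bot ℝ).1 (hb.le y.2)
    simp [projFun, h2]
  rw [projNorm]
  simp_rw [h1]
  let L : (⊤ : Submodule ℝ (EuclideanSpace ℝ (Fin n))) ≃ₗᵢ[ℝ] EuclideanSpace ℝ (Fin n) :=
    { Submodule.topEquiv with norm_map' := fun x => rfl }
  exact L.measurePreserving.lintegral_comp_emb L.toHomeomorph.measurableEmbedding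
    fun x => ENNReal.ofReal (f x)

lemma spanOn_univ {u : Fin n → EuclideanSpace ℝ (Fin n)} (hu : LinearIndependent ℝ u) :
    spanOn u Finset.univ = ⊤ := by
  apply Submodule.eq_top_of_finrank_eq
  rw [finrank_spanOn hu]
  simp

variable {u : Fin n → EuclideanSpace ℝ (Fin n)} (hu : LinearIndependent ℝ u)

include hu in
lemma innerCoords_split_injective (S : Finset (Fin n)) :
    Function.Injective ((innerCoords fun i : S => u i).prod
      (innerCoords fun i : ↥(Sᶜ) => u i)) := by
  rw [← LinearMap.ker_eq_bot, LinearMap.ker_eq_bot']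
  intro x hx
  have h1 : ∀ k, inner ℝ (u k) x = 0 := by
    intro k
    by_cases hk : k ∈ S
    · exact congrFun (Prod.ext_iff.1 hx).1 ⟨k, hk⟩
    · exact congrFun (Prod.ext_iff.1 hx).2 ⟨k, Finset.mem_compl.2 hk⟩
  have h2 : x ∈ (spanOn u Finset.univ)ᗮ := by
    rw [Submodule.mem_orthogonal]
    intro v hv
    induction hv using Submodule.span_induction with
    | mem v hv =>
      obtain ⟨k, -, rfl⟩ := hv
      exact h1 k
    | zero => simp
    | add a b _ _ ha hb => rw [inner_add_left, ha, hb, add_zero]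
    | smul c a _ ha => rw [inner_smul_left, ha, mul_zero]
  rwa [spanOn_univ hu, Submodule.top_orthogonal_eq_bot, Submodule.mem_bot] at h2

/-- The coordinates `⟪u i, x⟫`, split according to whether `i ∈ S`. -/
noncomputable def splitCoords (S : Finset (Fin n)) :
    EuclideanSpace ℝ (Fin n) ≃ₗ[ℝ] (S → ℝ) × (↥(Sᶜ) → ℝ) :=
  LinearMap.linearEquivOfInjective _ (innerCoords_split_injective hu S) (by
    simp
    have := Finset.card_le_univ S
    simp at this
    omega)

-- Compares the product-space form used by the coordinate inequality with the projection onto a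
-- single span; the case `A = S ∪ Sᶜ` recovers the integral of `f` itself.
include hu in
lemma lintegral_supFiber_prod {f : EuclideanSpace ℝ (Fin n) → ℝ} (hf : IsLogConcave f)
    {A : Finset (Fin n)} {β γ : Type*} [Fintype β] [DecidableEq β] [Fintype γ] [DecidableEq γ]
    (e : β ⊕ γ ≃ A) :
    ∫⁻ p : (β → ℝ) × (γ → ℝ), supFiber (fun x => (innerCoords (fun b => u (e (.inl b))) x,
      innerCoords (fun c => u (e (.inr c))) x)) (fun x => ENNReal.ofReal (f x)) p =
      ENNReal.ofReal (wedgeVol u A) * projNorm (spanOn u A) f := by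
  rw [← lintegral_supFiber_innerCoords hu hf e]
  rw [← (volume_measurePreserving_sumPiEquivProdPi (fun _ : β ⊕ γ => ℝ)).lintegral_comp_emb
    (MeasurableEquiv.measurableEmbedding _)]
  refine lintegral_congr fun y => ?_
  apply le_antisymm
  · refine supFiber_le_iff.2 fun x hx => ?_
    have : innerCoords (fun b => u (e b)) x = y := by
      funext b
      rcases b with b | c
      · exact congrFun (Prod.ext_iff.1 hx).1 b
      · exact congrFun (Prod.ext_iff.1 hx).2 c
    rw [← this]
    exact le_supFiber (innerCoords fun b => u (e b)) (fun x => ENNReal.ofReal (f x)) x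
  · refine supFiber_le_iff.2 fun x hx => ?_
    rw [← hx]
    exact le_supFiber (fun x => (innerCoords (fun b => u (e (.inl b))) x,
      innerCoords (fun c => u (e (.inr c))) x)) (fun x => ENNReal.ofReal (f x)) x

/-- Splitting `T ∪ Sᶜ`, for `T ⊆ S`, into a subset of `S` and `Sᶜ`. -/
noncomputable def unionComplEquiv {S T : Finset (Fin n)} (hT : T ⊆ S) :
    ↥(T.subtype (· ∈ S)) ⊕ ↥(Sᶜ) ≃ ↥(T ∪ Sᶜ) :=
  Equiv.ofBijective (Sum.elim
    (fun i => ⟨i.1.1, Finset.mem_union_left _ (Finset.mem_subtype.1 i.2)⟩)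
    (fun k => ⟨k.1, Finset.mem_union_right _ k.2⟩)) (by
  constructor
  · rintro (⟨⟨i, hi⟩, hi'⟩ | ⟨k, hk⟩) (⟨⟨j, hj⟩, hj'⟩ | ⟨l, hl⟩) h
    · simpa using h
    · have : i = l := by simpa using h
      subst this
      exact absurd hi (Finset.mem_compl.1 hl)
    · have : k = j := by simpa using h
      subst this
      exact absurd hj (Finset.mem_compl.1 hk)
    · simpa using h
  · rintro ⟨k, hk⟩
    rcases Finset.mem_union.1 hk with hk' | hk'
    · exact ⟨.inl ⟨⟨k, hT hk'⟩, Finset.mem_subtype.2 hk'⟩, rfl⟩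
    · exact ⟨.inr ⟨k, hk'⟩, rfl⟩)

-- The common source of all four inequalities. In the coordinates `⟪u i, x⟫` the factor `Z` is
-- `ℝ^(Sᶜ)`, so keeping the coordinates in `T j` and in `Z` means projecting onto the span of `u`
-- over `T j ∪ Sᶜ`.
include hu in
lemma projNorm_rpow_mul_lintegral_le {S : Finset (Fin n)} (hS : S.Nonempty)
    {T : Fin m → Finset (Fin n)} {q : Fin m → ℝ} (hcover : IsUniformCover S T q)
    {f : EuclideanSpace ℝ (Fin n) → ℝ} (hf : IsLogConcave f) :
    (ENNReal.ofReal (wedgeVol u Sᶜ) * projNorm (spanOn u Sᶜ) f) ^ (∑ j, q j - 1) *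
      (ENNReal.ofReal (wedgeVol u Finset.univ) * ∫⁻ x, ENNReal.ofReal (f x)) ≤
    (S.card ! : ℝ≥0∞) * (∏ j, ((T j).card ! : ℝ≥0∞) ^ q j)⁻¹ *
      ∏ j, (ENNReal.ofReal (wedgeVol u (T j ∪ Sᶜ)) * projNorm (spanOn u (T j ∪ Sᶜ)) f) ^ q j := by
  have hSne : Nonempty S := hS.to_subtype
  set G : EuclideanSpace ℝ (Fin n) → ℝ≥0∞ := fun x => ENNReal.ofReal (f x) with hG
  set Φ := splitCoords hu S with hΦ
  set g : (S → ℝ) × (↥(Sᶜ) → ℝ) → ℝ≥0∞ := fun y => G (Φ.symm y) with hg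
  have hglc : ENNLogConcave g := hf.ennLogConcave.comp_linearMap Φ.symm.toLinearMap
  have key := fibreSup_rpow_mul_lintegral_le (volume : Measure (↥(Sᶜ) → ℝ)) hglc
    (T := fun j => (T j).subtype (· ∈ S)) hcover.weight_pos
    (fun i => by simpa using hcover.cover i i.2)
  have hcard : ∀ j, ((T j).subtype (· ∈ S)).card = (T j).card := fun j => by
    rw [Finset.card_subtype, Finset.filter_true_of_mem fun i hi => hcover.subset j hi]
  simp_rw [hcard, Fintype.card_coe] at key
  have hM : ∫⁻ z, fibreSup g z = ENNReal.ofReal (wedgeVol u Sᶜ) * projNorm (spanOn u Sᶜ) f := by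
    rw [← lintegral_supFiber_innerCoords hu hf (Equiv.refl _), fibreSup]
    have := supFiber_comp_equiv Φ.toEquiv (LinearMap.snd ℝ (S → ℝ) (↥(Sᶜ) → ℝ)) G
    exact congrArg (fun F => ∫⁻ z, F z) this
  have hN : ∀ j, ∫⁻ p, supFiber (coordProj (↥(Sᶜ) → ℝ) ((T j).subtype (· ∈ S))) g p
      ∂(volume.prod volume) =
      ENNReal.ofReal (wedgeVol u (T j ∪ Sᶜ)) * projNorm (spanOn u (T j ∪ Sᶜ)) f := by
    intro j
    rw [← lintegral_supFiber_prod hu hf (unionComplEquiv (hcover.subset j))]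
    have := supFiber_comp_equiv Φ.toEquiv (coordProj (↥(Sᶜ) → ℝ) ((T j).subtype (· ∈ S))) G
    exact congrArg (fun F => ∫⁻ z, F z) this
  have hfull : ∫⁻ p, g p ∂(volume.prod volume) =
      ENNReal.ofReal (wedgeVol u Finset.univ) * ∫⁻ x, ENNReal.ofReal (f x) := by
    have hU : S ∪ Sᶜ = Finset.univ := Finset.union_compl S
    rw [← projNorm_top, ← spanOn_univ hu, ← hU,
      ← lintegral_supFiber_prod hu hf (Equiv.Finset.union S Sᶜ disjoint_compl_right)]
    have := supFiber_comp_equiv Φ.toEquiv id G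
    refine (lintegral_congr fun p => ?_).trans (congrArg (fun F => ∫⁻ z, F z) this)
    exact (supFiber_id _ _).symm
  simp_rw [hN] at key
  rwa [hM, hfull] at key

end Basis

/-! ### The dual basis and complementary minors -/

section DualBasis

variable {n : ℕ}

lemma mem_spanOn_orthogonal {w : Fin n → EuclideanSpace ℝ (Fin n)} {B : Finset (Fin n)}
    {x : EuclideanSpace ℝ (Fin n)} : x ∈ (spanOn w B)ᗮ ↔ ∀ k ∈ B, inner ℝ (w k) x = 0 := by
  rw [Submodule.mem_orthogonal]
  constructor
  · intro h k hk
    exact h _ (mem_spanOn w ⟨k, hk⟩)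
  · intro h v hv
    induction hv using Submodule.span_induction with
    | mem v hv =>
      obtain ⟨k, hk, rfl⟩ := hv
      exact h k hk
    | zero => simp
    | add a b _ _ ha hb => rw [inner_add_left, ha, hb, add_zero]
    | smul c a _ ha => rw [inner_smul_left, ha, mul_zero]

/-- The complementary minor formula of Jacobi for a principal minor of an inverse matrix. -/
lemma Matrix.det_toSquareBlockProp_not_of_mul_eq_one {ι : Type*} [Fintype ι] [DecidableEq ι]
    {G N : Matrix ι ι ℝ} (h : G * N = 1) (p : ι → Prop) [DecidablePred p] :
    G.det * (N.toSquareBlockProp fun i => ¬p i).det = (G.toSquareBlockProp p).det := by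
  -- `M` has the columns of the identity on `p` and those of `N` elsewhere, so `G * M` has the
  -- columns of `G` on `p` and of the identity elsewhere. Both are block triangular.
  set M : Matrix ι ι ℝ := Matrix.of fun i j => if p j then (1 : Matrix ι ι ℝ) i j else N i j with hM
  have hM1 : M.det = (N.toSquareBlockProp fun i => ¬p i).det := by
    rw [Matrix.twoBlockTriangular_det M p (fun i hi j hj => by
      simp only [hM, Matrix.of_apply, hj, if_true]
      exact Matrix.one_apply_ne (by rintro rfl; exact hi hj))]
    have h1 : M.toSquareBlockProp p = 1 := by
      ext i j
      simp [hM, Matrix.toSquareBlockProp_def, j.2, Matrix.one_apply, Subtype.ext_iff]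
    have h2 : (M.toSquareBlockProp fun i => ¬p i) = N.toSquareBlockProp fun i => ¬p i := by
      ext i j
      simp [hM, Matrix.toSquareBlockProp_def, j.2]
    rw [h1, h2, Matrix.det_one, one_mul]
  have hGM : ∀ i j, (G * M) i j = if p j then G i j else (1 : Matrix ι ι ℝ) i j := by
    intro i j
    rw [← h]
    by_cases hj : p j
    · simp [Matrix.mul_apply, hM, hj, Matrix.one_apply]
    · simp [Matrix.mul_apply, hM, hj]
  rw [← hM1, ← Matrix.det_mul, Matrix.twoBlockTriangular_det' (G * M) p (fun i hi j hj => by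
      rw [hGM, if_neg hj]
      exact Matrix.one_apply_ne (by rintro rfl; exact hj hi))]
  have h1 : (G * M).toSquareBlockProp p = G.toSquareBlockProp p := by
    ext i j
    rw [Matrix.toSquareBlockProp_def, Matrix.toSquareBlockProp_def, Matrix.of_apply,
      Matrix.of_apply, hGM, if_pos j.2]
  have h2 : ((G * M).toSquareBlockProp fun i => ¬p i) = 1 := by
    ext i j
    rw [Matrix.toSquareBlockProp_def, Matrix.of_apply, hGM, if_neg j.2]
    simp [Matrix.one_apply, Subtype.ext_iff]
  rw [h1, h2, Matrix.det_one, mul_one]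

variable (w : Module.Basis (Fin n) ℝ (EuclideanSpace ℝ (Fin n)))

/-- The family dual to the basis `w` with respect to the inner product. -/
noncomputable def dualFamily (i : Fin n) : EuclideanSpace ℝ (Fin n) :=
  (InnerProductSpace.toDual ℝ (EuclideanSpace ℝ (Fin n))).symm
    (LinearMap.toContinuousLinearMap (w.coord i))

lemma inner_dualFamily (i j : Fin n) : inner ℝ (dualFamily w i) (w j) = if i = j then 1 else 0 := by
  rw [dualFamily, InnerProductSpace.toDual_symm_apply]
  simp [Finsupp.single_apply, eq_comm]

lemma linearIndependent_dualFamily : LinearIndependent ℝ (dualFamily w) := by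
  rw [Fintype.linearIndependent_iff]
  intro c hc j
  have h1 : inner ℝ (∑ i, c i • dualFamily w i) (w j) = 0 := by rw [hc, inner_zero_left]
  simpa [sum_inner, inner_smul_left, inner_dualFamily] using h1

lemma sum_inner_smul_dualFamily (x : EuclideanSpace ℝ (Fin n)) :
    ∑ k, inner ℝ (w k) x • dualFamily w k = x := by
  refine InnerProductSpace.ext_inner_left_basis w fun j => ?_
  rw [inner_sum]
  simp_rw [inner_smul_right, real_inner_comm, inner_dualFamily]
  simp

/-- The coefficients of `x` in the dual family are `⟪w k, x⟫`, and these vanish for all `k ∈ B`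
exactly on the orthogonal complement. -/
lemma spanOn_dualFamily_compl (B : Finset (Fin n)) :
    spanOn (dualFamily w) Bᶜ = (spanOn w B)ᗮ := by
  apply le_antisymm
  · rw [spanOn, Submodule.span_le]
    rintro _ ⟨k, hk, rfl⟩
    have hk' : k ∉ B := by simpa using hk
    refine mem_spanOn_orthogonal.2 fun j hj => ?_
    rw [real_inner_comm, inner_dualFamily, if_neg]
    rintro rfl
    exact hk' hj
  · intro x hx
    rw [← sum_inner_smul_dualFamily w x]
    refine Submodule.sum_mem _ fun k _ => ?_
    by_cases hk : k ∈ B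
    · rw [mem_spanOn_orthogonal.1 hx k hk, zero_smul]
      exact Submodule.zero_mem _
    · exact Submodule.smul_mem _ _ (mem_spanOn _ ⟨k, Finset.mem_compl.2 hk⟩)

lemma gram_mul_gram_dualFamily :
    Matrix.gram ℝ w * Matrix.gram ℝ (dualFamily w) = 1 := by
  ext i j
  have h1 : inner ℝ (w i) (∑ k, inner ℝ (w k) (w i) • dualFamily w k) = inner ℝ (w i) (w i) := by
    rw [sum_inner_smul_dualFamily]
  have h2 : inner ℝ (dualFamily w j) (∑ k, inner ℝ (w k) (w i) • dualFamily w k)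
      = inner ℝ (dualFamily w j) (w i) := by
    rw [sum_inner_smul_dualFamily]
  rw [inner_sum, inner_dualFamily] at h2
  simp only [inner_smul_right] at h2
  rw [Matrix.mul_apply, Matrix.one_apply]
  simp only [Matrix.gram_apply]
  rw [show (if i = j then (1 : ℝ) else 0) = if j = i then 1 else 0 by simp [eq_comm], ← h2]
  refine Finset.sum_congr rfl fun k _ => ?_
  rw [real_inner_comm (w i) (w k), real_inner_comm (dualFamily w k) (dualFamily w j)]

lemma wedgeVol_univ {u : Fin n → EuclideanSpace ℝ (Fin n)} (hu : LinearIndependent ℝ u) :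
    wedgeVol u Finset.univ = Real.sqrt (Matrix.gram ℝ u).det :=
  wedgeVol_eq_of_equiv hu (Equiv.subtypeUnivEquiv Finset.mem_univ).symm

/-- The Gram matrices of `w` and of its dual family are mutually inverse, so this is the square root
of Jacobi's formula. -/
lemma wedgeVol_dualFamily_compl (B : Finset (Fin n)) :
    wedgeVol (dualFamily w) Bᶜ = wedgeVol w B / wedgeVol w Finset.univ := by
  have hw := w.linearIndependent
  rw [eq_div_iff (wedgeVol_pos hw _).ne', wedgeVol_eq_sqrt_det_gram hw B, wedgeVol_univ hw,
    wedgeVol_eq_of_equiv (linearIndependent_dualFamily w)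
    (Equiv.subtypeEquivRight (p := fun k => ¬k ∈ B) (q := fun k => k ∈ Bᶜ) (by simp)),
    mul_comm, ← Real.sqrt_mul (Matrix.posDef_gram_of_linearIndependent hw).det_pos.le]
  congr 1
  convert Matrix.det_toSquareBlockProp_not_of_mul_eq_one (gram_mul_gram_dualFamily w) (· ∈ B)
  · rfl
  · rfl

end DualBasis

/-! ### Completion by an orthonormal basis of the orthogonal complement -/

section OrthogonalCompletion

variable {n : ℕ}

lemma wedgeVol_empty {w : Fin n → EuclideanSpace ℝ (Fin n)} (hw : LinearIndependent ℝ w) :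
    wedgeVol w ∅ = 1 := by
  rw [wedgeVol_eq_sqrt_det_gram hw, Matrix.det_isEmpty, Real.sqrt_one]

/-- The vectors `w k`, `k ∈ S`, can be completed to a basis by an orthonormal basis of the
orthogonal complement of their span. -/
lemma exists_orthogonal_completion {w : Fin n → EuclideanSpace ℝ (Fin n)}
    (hw : LinearIndependent ℝ w) (S : Finset (Fin n)) :
    ∃ u : Fin n → EuclideanSpace ℝ (Fin n), LinearIndependent ℝ u ∧ (∀ i ∈ S, u i = w i) ∧
      (∀ k ∈ Sᶜ, u k ∈ (spanOn w S)ᗮ) ∧ Orthonormal ℝ fun k : ↥(Sᶜ) => u k := by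
  have hd : Module.finrank ℝ (spanOn w S)ᗮ = Fintype.card ↥(Sᶜ) := by
    have h1 := Submodule.finrank_add_finrank_orthogonal (spanOn w S)
    rw [finrank_spanOn hw, finrank_euclideanSpace_fin] at h1
    rw [Fintype.card_coe, Finset.card_compl, Fintype.card_fin]
    omega
  obtain ⟨o⟩ := exists_orthonormalBasis_of_card_eq hd
  set u : Fin n → EuclideanSpace ℝ (Fin n) := fun k =>
    if hk : k ∈ S then w k else o ⟨k, Finset.mem_compl.2 hk⟩ with hu
  have hu1 : ∀ i ∈ S, u i = w i := fun i hi => by simp [hu, hi]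
  have hu2 : ∀ k : ↥(Sᶜ), u k = o k := fun k => by
    have := Finset.mem_compl.1 k.2
    simp [hu, this]
  have hu3 : ∀ k ∈ Sᶜ, u k ∈ (spanOn w S)ᗮ := fun k hk => by
    rw [hu2 ⟨k, hk⟩]; exact (o _).2
  have hu4 : Orthonormal ℝ fun k : ↥(Sᶜ) => u k := by
    simp_rw [hu2]
    exact o.orthonormal.comp_linearIsometry (spanOn w S)ᗮ.subtypeₗᵢ
  refine ⟨u, ?_, hu1, hu3, hu4⟩
  rw [Fintype.linearIndependent_iff]
  intro c hc
  have hsplit : ∑ k ∈ S, c k • w k + ∑ k : ↥(Sᶜ), c k • u k = 0 := by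
    rw [← hc, ← Finset.sum_add_sum_compl S]
    congr 1
    · exact Finset.sum_congr rfl fun k hk => by rw [hu1 k hk]
    · exact Finset.sum_coe_sort Sᶜ fun k => c k • u k
  have hx : ∑ k ∈ S, c k • w k ∈ spanOn w S :=
    Submodule.sum_mem _ fun k hk => Submodule.smul_mem _ _ (mem_spanOn w ⟨k, hk⟩)
  have hy : ∑ k : ↥(Sᶜ), c k • u k ∈ (spanOn w S)ᗮ :=
    Submodule.sum_mem _ fun k _ => Submodule.smul_mem _ _ (hu3 k k.2)
  have hx0 : ∑ k ∈ S, c k • w k = 0 := by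
    have h1 : ∑ k ∈ S, c k • w k = -∑ k : ↥(Sᶜ), c k • u k := eq_neg_of_add_eq_zero_left hsplit
    have h2 : ∑ k ∈ S, c k • w k ∈ (spanOn w S)ᗮ := by
      rw [h1]; exact Submodule.neg_mem _ hy
    exact inner_self_eq_zero.1 ((Submodule.mem_orthogonal _ _).1 h2 _ hx)
  rw [hx0, zero_add] at hsplit
  intro k
  by_cases hk : k ∈ S
  · exact linearIndependent_iff'.1 hw S c hx0 k hk
  · exact Fintype.linearIndependent_iff.1 hu4.linearIndependent (fun k => c k) hsplit
      ⟨k, Finset.mem_compl.2 hk⟩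

variable {w u : Fin n → EuclideanSpace ℝ (Fin n)} {S : Finset (Fin n)}

/-- The Gram matrix is block diagonal, and its block over `Sᶜ` is the identity. -/
lemma wedgeVol_union_compl (hw : LinearIndependent ℝ w) (hu : LinearIndependent ℝ u)
    (h1 : ∀ i ∈ S, u i = w i) (h2 : ∀ k ∈ Sᶜ, u k ∈ (spanOn w S)ᗮ)
    (h3 : Orthonormal ℝ fun k : ↥(Sᶜ) => u k) {T : Finset (Fin n)} (hT : T ⊆ S) :
    wedgeVol u (T ∪ Sᶜ) = wedgeVol w T := by
  have hdisj : Disjoint T Sᶜ := disjoint_compl_right.mono_left hT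
  rw [wedgeVol_eq_of_equiv hu (Equiv.Finset.union T Sᶜ hdisj), wedgeVol_eq_sqrt_det_gram hw]
  congr 1
  have hperp : ∀ (i : T) (k : ↥(Sᶜ)), inner ℝ (w i) (u k) = 0 := fun i k =>
    mem_spanOn_orthogonal.1 (h2 k k.2) i (hT i.2)
  have : (Matrix.gram ℝ fun b => u (Equiv.Finset.union T Sᶜ hdisj b)) =
      Matrix.fromBlocks (Matrix.gram ℝ fun k : T => w k) 0 0 1 := by
    rw [← Matrix.gram_eq_one_iff_orthonormal.2 h3]
    ext (i | i) (j | j)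
    · simp [Matrix.gram_apply, h1 _ (hT i.2), h1 _ (hT j.2)]
    · simpa [Matrix.gram_apply, h1 _ (hT i.2)] using hperp i j
    · simpa [Matrix.gram_apply, h1 _ (hT j.2), real_inner_comm] using hperp j i
    · simp [Matrix.gram_apply]
  rw [this, Matrix.det_fromBlocks_zero₂₁, Matrix.det_one, mul_one]

lemma spanOn_compl_eq_orthogonal (hw : LinearIndependent ℝ w) (hu : LinearIndependent ℝ u)
    (h2 : ∀ k ∈ Sᶜ, u k ∈ (spanOn w S)ᗮ) : spanOn u Sᶜ = (spanOn w S)ᗮ := by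
  refine Submodule.eq_of_le_of_finrank_eq ?_ ?_
  · rw [spanOn, Submodule.span_le]
    rintro _ ⟨k, hk, rfl⟩
    exact h2 k hk
  · have h4 := Submodule.finrank_add_finrank_orthogonal (spanOn w S)
    rw [finrank_spanOn hw, finrank_euclideanSpace_fin] at h4
    rw [finrank_spanOn hu, Finset.card_compl, Fintype.card_fin]
    omega

lemma spanOn_union_compl (hw : LinearIndependent ℝ w) (hu : LinearIndependent ℝ u)
    (h1 : ∀ i ∈ S, u i = w i) (h2 : ∀ k ∈ Sᶜ, u k ∈ (spanOn w S)ᗮ) {T : Finset (Fin n)}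
    (hT : T ⊆ S) : spanOn u (T ∪ Sᶜ) = spanOn w T ⊔ (spanOn w S)ᗮ := by
  rw [← spanOn_compl_eq_orthogonal hw hu h2, spanOn, Finset.coe_union, Set.image_union,
    Submodule.span_union]
  congr 1
  rw [spanOn, Set.image_congr fun i hi => h1 i (hT hi)]

end OrthogonalCompletion

/-! ### Moving the constants through powers and products -/

section Constants

variable {κ : Type*} [Fintype κ]

lemma ENNReal.prod_ofReal_mul_rpow {D q : κ → ℝ} (hD : ∀ j, 0 < D j) (hq : ∀ j, 0 < q j)
    (P : κ → ℝ≥0∞) :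
    ∏ j, (ENNReal.ofReal (D j) * P j) ^ q j = ENNReal.ofReal (∏ j, D j ^ q j) * ∏ j, P j ^ q j := by
  rw [ENNReal.ofReal_prod_of_nonneg fun j _ => Real.rpow_nonneg (hD j).le _,
    ← Finset.prod_mul_distrib]
  refine Finset.prod_congr rfl fun j _ => ?_
  rw [ENNReal.mul_rpow_of_nonneg _ _ (hq j).le, ENNReal.ofReal_rpow_of_pos (hD j)]

lemma rpow_mul_le_of_scaled_le {D₀ D₁ r A : ℝ} {c D q : κ → ℝ} (hD₀ : 0 < D₀) (hD₁ : 0 < D₁)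
    (hr : 0 ≤ r) (hA : 0 ≤ A) (hc : ∀ j, 0 < c j) (hD : ∀ j, 0 < D j) (hq : ∀ j, 0 < q j)
    {P₀ F : ℝ≥0∞} {P : κ → ℝ≥0∞}
    (h : (ENNReal.ofReal D₀ * P₀) ^ r * (ENNReal.ofReal D₁ * F) ≤
      ENNReal.ofReal A * (∏ j, ENNReal.ofReal (c j) ^ q j)⁻¹ *
        ∏ j, (ENNReal.ofReal (D j) * P j) ^ q j) :
    P₀ ^ r * F ≤ ENNReal.ofReal (A * (∏ j, D j ^ q j) / (D₀ ^ r * D₁ * ∏ j, c j ^ q j)) *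
      ∏ j, P j ^ q j := by
  have hC : 0 < ∏ j, c j ^ q j := Finset.prod_pos fun j _ => Real.rpow_pos_of_pos (hc j) _
  have hDp : 0 < ∏ j, D j ^ q j := Finset.prod_pos fun j _ => Real.rpow_pos_of_pos (hD j) _
  have hκ : 0 < D₀ ^ r * D₁ := by positivity
  have hc' : ∏ j, ENNReal.ofReal (c j) ^ q j = ENNReal.ofReal (∏ j, c j ^ q j) := by
    rw [ENNReal.ofReal_prod_of_nonneg fun j _ => Real.rpow_nonneg (hc j).le _]
    exact Finset.prod_congr rfl fun j _ => ENNReal.ofReal_rpow_of_pos (hc j)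
  rw [hc', ENNReal.prod_ofReal_mul_rpow hD hq, ENNReal.mul_rpow_of_nonneg _ _ hr,
    ENNReal.ofReal_rpow_of_pos hD₀, ← ENNReal.ofReal_inv_of_pos hC] at h
  refine (ENNReal.mul_le_mul_iff_right (a := ENNReal.ofReal (D₀ ^ r * D₁)) (by simpa using hκ)
    ENNReal.ofReal_ne_top).1 ?_
  calc ENNReal.ofReal (D₀ ^ r * D₁) * (P₀ ^ r * F)
      = ENNReal.ofReal (D₀ ^ r) * P₀ ^ r * (ENNReal.ofReal D₁ * F) := by
        rw [ENNReal.ofReal_mul (by positivity)]; ring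
    _ ≤ _ := h
    _ = ENNReal.ofReal (A * (∏ j, c j ^ q j)⁻¹ * ∏ j, D j ^ q j) * ∏ j, P j ^ q j := by
        rw [ENNReal.ofReal_mul (by positivity), ENNReal.ofReal_mul hA]; ring
    _ = _ := by
        rw [← mul_assoc, ← ENNReal.ofReal_mul hκ.le]
        congr 2
        field_simp

/-- Raises the hypothesis to the power `s`. It serves with `s = p - 1`, after passing to the
complementary cover. -/
lemma mul_rpow_le_of_rpow_mul_le {A B s : ℝ} {a c q : κ → ℝ} (hA : 0 < A) (hB : 0 < B)
    (hs : 0 < s) (ha : ∀ j, 0 < a j) (hc : ∀ j, 0 < c j)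
    {X F : ℝ≥0∞} {P : κ → ℝ≥0∞}
    (h : X ^ s⁻¹ * F ≤ ENNReal.ofReal (A * (∏ j, a j ^ (q j / s)) / (B * ∏ j, c j ^ (q j / s))) *
      ∏ j, P j ^ (q j / s)) :
    X * F ^ s ≤ ENNReal.ofReal (A ^ s * (∏ j, a j ^ q j) / (B ^ s * ∏ j, c j ^ q j)) *
      ∏ j, P j ^ q j := by
  have hpos : ∀ a : κ → ℝ, (∀ j, 0 < a j) → 0 < ∏ j, a j ^ (q j / s) := fun a ha =>
    Finset.prod_pos fun j _ => Real.rpow_pos_of_pos (ha j) _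
  have hpow : ∀ a : κ → ℝ, (∀ j, 0 < a j) → (∏ j, a j ^ (q j / s)) ^ s = ∏ j, a j ^ q j := by
    intro a ha
    rw [← Real.finsetProd_rpow _ _ fun j _ => Real.rpow_nonneg (ha j).le _]
    refine Finset.prod_congr rfl fun j _ => ?_
    rw [← Real.rpow_mul (ha j).le, div_mul_cancel₀ _ hs.ne']
  have h1 := ENNReal.rpow_le_rpow h hs.le
  have ha' := hpos a ha
  have hc' := hpos c hc
  rw [ENNReal.mul_rpow_of_nonneg _ _ hs.le, ENNReal.mul_rpow_of_nonneg _ _ hs.le,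
    ← ENNReal.rpow_mul, inv_mul_cancel₀ hs.ne', ENNReal.rpow_one,
    ENNReal.ofReal_rpow_of_pos (by positivity), Real.div_rpow (by positivity) (by positivity),
    Real.mul_rpow hA.le ha'.le, Real.mul_rpow hB.le hc'.le, hpow a ha, hpow c hc,
    ← ENNReal.prod_rpow_of_nonneg hs.le] at h1
  convert h1 using 3 with j
  rw [← ENNReal.rpow_mul, div_mul_cancel₀ _ hs.ne']

end Constants

/-! ### Complementary covers -/

section Cover

variable {n m : ℕ} {S : Finset (Fin n)} {T : Fin m → Finset (Fin n)} {q : Fin m → ℝ}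

lemma IsUniformCover.one_le_sum (h : IsUniformCover S T q) (hS : S.Nonempty) : 1 ≤ ∑ j, q j := by
  obtain ⟨i, hi⟩ := hS
  rw [← h.cover i hi]
  refine Finset.sum_le_sum fun j _ => ?_
  split_ifs
  · simp
  · simpa using (h.weight_pos j).le

/-- For `i ∈ S` the sets `T j` missing `i` have total weight `p - 1`. -/
lemma IsUniformCover.compl (h : IsUniformCover S T q) (hp : 1 < ∑ j, q j) :
    IsUniformCover S (fun j => S \ T j) fun j => q j / (∑ j, q j - 1) where
  weight_pos j := div_pos (h.weight_pos j) (sub_pos.2 hp)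
  subset j := Finset.sdiff_subset
  cover i hi := by
    have h1 : ∀ j, q j / (∑ j, q j - 1) * (if i ∈ S \ T j then (1 : ℝ) else 0) =
        (q j - q j * (if i ∈ T j then 1 else 0)) / (∑ j, q j - 1) := by
      intro j
      by_cases hj : i ∈ T j <;> simp [hi, hj]
    simp_rw [h1]
    rw [← Finset.sum_div, Finset.sum_sub_distrib, h.cover i hi, div_self (sub_pos.2 hp).ne']

/-- An `i ∈ S` outside some `T j` would be covered with weight at most `1 - q j < 1`. This settles
the case without a complementary cover. -/
lemma IsUniformCover.eq_of_sum_eq_one (h : IsUniformCover S T q) (hp : ∑ j, q j = 1) (j : Fin m) :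
    T j = S := by
  refine (h.subset j).antisymm fun i hi => ?_
  by_contra hij
  have h1 := h.cover i hi
  refine (h1.trans hp.symm).not_lt (Finset.sum_lt_sum (fun k _ => ?_) ⟨j, Finset.mem_univ j, ?_⟩)
  · by_cases hk : i ∈ T k <;> simp [hk, (h.weight_pos k).le]
  · simpa [hij] using h.weight_pos j

end Cover

/-! ### The four inequalities -/

section Inequalities

variable {n m : ℕ} {w : Fin n → EuclideanSpace ℝ (Fin n)} {S : Finset (Fin n)}
  {T : Fin m → Finset (Fin n)} {q : Fin m → ℝ} {f : EuclideanSpace ℝ (Fin n) → ℝ}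

lemma projNorm_rpow_mul_le_prod_projNorm {u : Fin n → EuclideanSpace ℝ (Fin n)}
    (hu : LinearIndependent ℝ u) (hS : S.Nonempty) (hcover : IsUniformCover S T q)
    (hf : IsLogConcave f) :
    projNorm (spanOn u Sᶜ) f ^ (∑ j, q j - 1) * (∫⁻ x, ENNReal.ofReal (f x)) ≤
      ENNReal.ofReal ((S.card ! : ℝ) * (∏ j, wedgeVol u (T j ∪ Sᶜ) ^ q j) /
        (wedgeVol u Sᶜ ^ (∑ j, q j - 1) * wedgeVol u Finset.univ *
          ∏ j, ((T j).card ! : ℝ) ^ q j)) *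
      ∏ j, projNorm (spanOn u (T j ∪ Sᶜ)) f ^ q j := by
  refine rpow_mul_le_of_scaled_le (wedgeVol_pos hu _) (wedgeVol_pos hu _)
    (sub_nonneg.2 (hcover.one_le_sum hS)) (Nat.cast_nonneg _)
    (fun j => by exact_mod_cast Nat.factorial_pos _) (fun j => wedgeVol_pos hu _)
    hcover.weight_pos ?_
  simpa only [ENNReal.ofReal_natCast] using projNorm_rpow_mul_lintegral_le hu hS hcover hf

lemma projNorm_orthogonal_rpow_mul_le (w : Module.Basis (Fin n) ℝ (EuclideanSpace ℝ (Fin n)))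
    (hS : S.Nonempty) (hcover : IsUniformCover S T q) (hf : IsLogConcave f) :
    projNorm (spanOn w S)ᗮ f ^ (∑ j, q j - 1) * (∫⁻ x, ENNReal.ofReal (f x)) ≤
      ENNReal.ofReal ((S.card ! : ℝ) * (∏ j, wedgeVol w (S \ T j) ^ q j) /
        (wedgeVol w S ^ (∑ j, q j - 1) * ∏ j, ((T j).card ! : ℝ) ^ q j)) *
      ∏ j, projNorm (spanOn w (S \ T j))ᗮ f ^ q j := by
  have hw := w.linearIndependent
  have key := projNorm_rpow_mul_le_prod_projNorm (linearIndependent_dualFamily w) hS hcover hf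
  have hset : ∀ j, T j ∪ Sᶜ = (S \ T j)ᶜ := fun j => by
    ext k; simp [imp_iff_not_or, or_comm]
  have huniv : wedgeVol (dualFamily w) Finset.univ = 1 / wedgeVol w Finset.univ := by
    rw [← wedgeVol_empty hw, ← wedgeVol_dualFamily_compl, Finset.compl_empty]
  simp_rw [hset, spanOn_dualFamily_compl, wedgeVol_dualFamily_compl] at key
  refine key.trans (le_of_eq ?_)
  congr 2
  have hW := wedgeVol_pos hw Finset.univ
  have hWS := wedgeVol_pos hw S
  have hprod : ∏ j, (wedgeVol w (S \ T j) / wedgeVol w Finset.univ) ^ q j =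
      (∏ j, wedgeVol w (S \ T j) ^ q j) / wedgeVol w Finset.univ ^ ∑ j, q j := by
    rw [Real.rpow_sum_of_pos hW, ← Finset.prod_div_distrib]
    exact Finset.prod_congr rfl fun j _ =>
      Real.div_rpow (wedgeVol_pos hw _).le hW.le _
  have hC : 0 < ∏ j, ((T j).card ! : ℝ) ^ q j := Finset.prod_pos fun j _ =>
    Real.rpow_pos_of_pos (by exact_mod_cast Nat.factorial_pos _) _
  -- The full volume of `w` occurs with power `-p` in the numerator and `-(p - 1) - 1` in the
  -- denominator, hence drops out.
  rw [hprod, huniv, Real.div_rpow hWS.le hW.le, Real.rpow_sub_one hW.ne']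
  have hWp : 0 < wedgeVol w Finset.univ ^ ∑ j, q j := Real.rpow_pos_of_pos hW _
  have hWS' : 0 < wedgeVol w S ^ (∑ j, q j - 1) := Real.rpow_pos_of_pos hWS _
  field_simp

lemma projNorm_sup_rpow_mul_le (hw : LinearIndependent ℝ w) (hS : S.Nonempty)
    (hcover : IsUniformCover S T q) (hf : IsLogConcave f) :
    projNorm (spanOn w S)ᗮ f ^ (∑ j, q j - 1) * (∫⁻ x, ENNReal.ofReal (f x)) ≤
      ENNReal.ofReal ((S.card ! : ℝ) * (∏ j, wedgeVol w (T j) ^ q j) /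
        (wedgeVol w S * ∏ j, ((T j).card ! : ℝ) ^ q j)) *
      ∏ j, projNorm (spanOn w (T j) ⊔ (spanOn w S)ᗮ) f ^ q j := by
  obtain ⟨u, hu, h1, h2, h3⟩ := exists_orthogonal_completion hw S
  have key := projNorm_rpow_mul_le_prod_projNorm hu hS hcover hf
  have hw0 : wedgeVol u Sᶜ = 1 := by
    rw [← wedgeVol_empty hw, ← wedgeVol_union_compl hw hu h1 h2 h3 (Finset.empty_subset S),
      Finset.empty_union]
  have hw1 : wedgeVol u Finset.univ = wedgeVol w S := by
    rw [← wedgeVol_union_compl hw hu h1 h2 h3 (Finset.Subset.refl S), Finset.union_compl]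
  simp_rw [fun j => wedgeVol_union_compl hw hu h1 h2 h3 (hcover.subset j),
    fun j => spanOn_union_compl hw hu h1 h2 (hcover.subset j)] at key
  rwa [hw0, hw1, spanOn_compl_eq_orthogonal hw hu h2, Real.one_rpow, one_mul] at key

lemma projNorm_orthogonal_mul_rpow_le (w : Module.Basis (Fin n) ℝ (EuclideanSpace ℝ (Fin n)))
    (hS : S.Nonempty) (hcover : IsUniformCover S T q) (hf : IsLogConcave f) :
    projNorm (spanOn w S)ᗮ f * (∫⁻ x, ENNReal.ofReal (f x)) ^ (∑ j, q j - 1) ≤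
      ENNReal.ofReal ((S.card ! : ℝ) ^ (∑ j, q j - 1) * (∏ j, wedgeVol w (T j) ^ q j) /
        (wedgeVol w S * ∏ j, ((S \ T j).card ! : ℝ) ^ q j)) *
      ∏ j, projNorm (spanOn w (T j))ᗮ f ^ q j := by
  have hw := w.linearIndependent
  have hWS := wedgeVol_pos hw S
  rcases (hcover.one_le_sum hS).eq_or_lt with hp | hp
  · have hT := hcover.eq_of_sum_eq_one hp.symm
    have h0 : ∀ j, 0 ≤ q j := fun j => (hcover.weight_pos j).le
    simp only [hT, ← hp, sub_self, ENNReal.rpow_zero, Real.rpow_zero, mul_one, one_mul,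
      Finset.sdiff_self, Finset.card_empty, Nat.factorial_zero, Nat.cast_one, Real.one_rpow,
      Finset.prod_const_one, ENNReal.prod_rpow_const _ _ h0, ← Real.rpow_sum_of_pos hWS,
      ENNReal.rpow_one, Real.rpow_one, div_self hWS.ne', ENNReal.ofReal_one, le_refl]
  · have hs := sub_pos.2 hp
    have key := projNorm_orthogonal_rpow_mul_le w hS (hcover.compl hp) hf
    -- The complementary weights sum to `p / (p - 1)`, so the exponent on the left is `1 / (p - 1)`,
    -- which the power `p - 1` turns into 1.
    have hsum : ∑ j, q j / (∑ j, q j - 1) - 1 = (∑ j, q j - 1)⁻¹ := by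
      rw [← Finset.sum_div]; field_simp; ring
    have hset : ∀ j, S \ (S \ T j) = T j := fun j =>
      Finset.sdiff_sdiff_eq_self (hcover.subset j)
    simp_rw [hset, hsum] at key
    have := mul_rpow_le_of_rpow_mul_le (by exact_mod_cast Nat.factorial_pos _)
      (Real.rpow_pos_of_pos hWS _) hs (fun j => wedgeVol_pos hw _)
      (fun j => by exact_mod_cast Nat.factorial_pos _) key
    rwa [← Real.rpow_mul hWS.le, inv_mul_cancel₀ hs.ne', Real.rpow_one] at this

lemma projNorm_sup_mul_rpow_le (hw : LinearIndependent ℝ w) (hS : S.Nonempty)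
    (hcover : IsUniformCover S T q) (hf : IsLogConcave f) :
    projNorm (spanOn w S)ᗮ f * (∫⁻ x, ENNReal.ofReal (f x)) ^ (∑ j, q j - 1) ≤
      ENNReal.ofReal ((S.card ! : ℝ) ^ (∑ j, q j - 1) * (∏ j, wedgeVol w (S \ T j) ^ q j) /
        (wedgeVol w S ^ (∑ j, q j - 1) * ∏ j, ((S \ T j).card ! : ℝ) ^ q j)) *
      ∏ j, projNorm (spanOn w (S \ T j) ⊔ (spanOn w S)ᗮ) f ^ q j := by
  have hWS := wedgeVol_pos hw S
  rcases (hcover.one_le_sum hS).eq_or_lt with hp | hp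
  · have hT := hcover.eq_of_sum_eq_one hp.symm
    have h0 : ∀ j, 0 ≤ q j := fun j => (hcover.weight_pos j).le
    have hbot : spanOn w ∅ = ⊥ := by simp [spanOn]
    simp only [hT, ← hp, sub_self, ENNReal.rpow_zero, Real.rpow_zero, mul_one, one_mul,
      Finset.sdiff_self, Finset.card_empty, Nat.factorial_zero, Nat.cast_one, Real.one_rpow,
      Finset.prod_const_one, wedgeVol_empty hw, hbot, bot_sup_eq, ENNReal.prod_rpow_const _ _ h0,
      ENNReal.rpow_one, div_one, ENNReal.ofReal_one, le_refl]
  · have hs := sub_pos.2 hp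
    have key := projNorm_sup_rpow_mul_le hw hS (hcover.compl hp) hf
    have hsum : ∑ j, q j / (∑ j, q j - 1) - 1 = (∑ j, q j - 1)⁻¹ := by
      rw [← Finset.sum_div]; field_simp; ring
    simp_rw [hsum] at key
    exact mul_rpow_le_of_rpow_mul_le (by exact_mod_cast Nat.factorial_pos _)
      hWS hs (fun j => wedgeVol_pos hw _)
      (fun j => by exact_mod_cast Nat.factorial_pos _) key

/-- Used for empty `S`, where `p` may be less than 1. At `F = 0` the left side is 0 even if `F ^ (p
- 1) = ∞`, while the right side is 1 for `p = 0`; so equality can fail. -/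
lemma ENNReal.rpow_sub_one_mul_self_le {F : ℝ≥0∞} (hF : F ≠ ⊤) (p : ℝ) :
    F ^ (p - 1) * F ≤ F ^ p := by
  by_cases h0 : F = 0
  · rw [h0, mul_zero]; exact zero_le
  · conv_lhs => rw [← ENNReal.rpow_one F, ← ENNReal.rpow_mul, one_mul]
    rw [← ENNReal.rpow_add _ _ h0 hF, sub_add_cancel]

end Inequalities

theorem mainTheorem9 {n m : ℕ}
    (w : Module.Basis (Fin n) ℝ (EuclideanSpace ℝ (Fin n)))
    (S : Finset (Fin n)) (T : Fin m → Finset (Fin n)) (q : Fin m → ℝ)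
    (hcover : IsUniformCover S T q) (p : ℝ) (hp : p = ∑ j, q j)
    (f : EuclideanSpace ℝ (Fin n) → ℝ) (hf : IsLogConcave f) (hint : Integrable f volume) :
    (projNorm (spanOn w S)ᗮ f ^ (p - 1) * (∫⁻ x, ENNReal.ofReal (f x)) ≤
      ENNReal.ofReal
        ((S.card ! : ℝ) * (∏ j, wedgeVol w (S \ T j) ^ q j) /
          (wedgeVol w S ^ (p - 1) * ∏ j, ((T j).card ! : ℝ) ^ q j)) *
        ∏ j, projNorm (spanOn w (S \ T j))ᗮ f ^ q j) ∧
    (projNorm (spanOn w S)ᗮ f * (∫⁻ x, ENNReal.ofReal (f x)) ^ (p - 1) ≤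
      ENNReal.ofReal
        ((S.card ! : ℝ) ^ (p - 1) * (∏ j, wedgeVol w (T j) ^ q j) /
          (wedgeVol w S * ∏ j, ((S \ T j).card ! : ℝ) ^ q j)) *
        ∏ j, projNorm (spanOn w (T j))ᗮ f ^ q j) ∧
    (projNorm (spanOn w S)ᗮ f ^ (p - 1) * (∫⁻ x, ENNReal.ofReal (f x)) ≤
      ENNReal.ofReal
        ((S.card ! : ℝ) * (∏ j, wedgeVol w (T j) ^ q j) /
          (wedgeVol w S * ∏ j, ((T j).card ! : ℝ) ^ q j)) *
        ∏ j, projNorm (spanOn w (T j) ⊔ (spanOn w S)ᗮ) f ^ q j) ∧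
    (projNorm (spanOn w S)ᗮ f * (∫⁻ x, ENNReal.ofReal (f x)) ^ (p - 1) ≤
      ENNReal.ofReal
        ((S.card ! : ℝ) ^ (p - 1) * (∏ j, wedgeVol w (S \ T j) ^ q j) /
          (wedgeVol w S ^ (p - 1) * ∏ j, ((S \ T j).card ! : ℝ) ^ q j)) *
        ∏ j, projNorm (spanOn w (S \ T j) ⊔ (spanOn w S)ᗮ) f ^ q j) := by
  have hw := w.linearIndependent
  subst hp
  rcases S.eq_empty_or_nonempty with rfl | hS
  -- With `S = ∅` every constant is 1 and every projection is `f` itself, so all four inequalities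
  -- read `F ^ (p - 1) * F ≤ F ^ p` up to order.
  · have hT : ∀ j, T j = ∅ := fun j => Finset.subset_empty.1 (hcover.subset j)
    have h0 : ∀ j, 0 ≤ q j := fun j => (hcover.weight_pos j).le
    have hbot : spanOn w ∅ = ⊥ := by simp [spanOn]
    have hF : ∫⁻ x, ENNReal.ofReal (f x) ≠ ⊤ := hint.lintegral_lt_top.ne
    have hle := ENNReal.rpow_sub_one_mul_self_le hF (∑ j, q j)
    simp only [hT, Finset.sdiff_self, hbot, Submodule.bot_orthogonal_eq_top, sup_top_eq,
      projNorm_top, wedgeVol_empty hw, Finset.card_empty, Nat.factorial_zero, Nat.cast_one,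
      Real.one_rpow, Finset.prod_const_one, mul_one, div_one, ENNReal.ofReal_one, one_mul,
      ENNReal.prod_rpow_const _ _ h0]
    exact ⟨hle, (mul_comm _ _).trans_le hle, hle, (mul_comm _ _).trans_le hle⟩
  · exact ⟨projNorm_orthogonal_rpow_mul_le w hS hcover hf,
      projNorm_orthogonal_mul_rpow_le w hS hcover hf,
      projNorm_sup_rpow_mul_le hw hS hcover hf, projNorm_sup_mul_rpow_le hw hS hcover hf⟩
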